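/- Let $Z$ be a finite connected simplicial complex with fundamental group $\Gamma$, let $X$ be its universal cover, on which $\Gamma$ acts by deck transformations, and let $m$ be a positive weight on $Z$: a function on simplices with $m(\sigma)>0$ for every simplex $\sigma$ and, for every non-maximal simplex $\sigma$ of dimension $k$, $m(\sigma)=\sum m(\tau)$, the sum being over the $(k+1)$-simplices $\tau\supset\sigma$. Let $Y$ be a non-empty complete geodesic $CAT(0)$ space and let $\rho$ be an isometric action of $\Gamma$ on $Y$. Maps from $X$ to a metric space are maps defined on the vertices of $X$. For an equivariant map $f$ from $X$ to a metric space with an isometric action of $\Gamma$, put $$E(f)=\frac12\sum_{z}\sum_{z'\sim z}m(z,z')\,d(f(c),f(c'))^2,\qquad d(f,g)=\Big(\sum_z m(z)\,d(f(c),g(c))^2\Big)^{1/2},$$ where $z$ runs over the vertices of $Z$, $z'\sim z$ means that $z,z'$ span an edge, and $(c,c')$ is an edge of $X$ above $(z,z')$ (resp. $c$ is a vertex above $z$). The map $f$ is *harmonic* if it is a local minimum of $E$ on the space of equivariant maps with the distance $d$. For $y\in Y$, the tangent cone $T_yY$ is the completion of the space of constant speed geodesics issuing from $y$ with the distance $\lim_{t\to0^+}d(s(t),s'(t))/t$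 (geodesics at distance zero being identified), its apex is the constant geodesic, and $\pi:Y\to T_yY$ maps $y'$ to the geodesic from $y$ to $y'$ parametrized by $[0,1]$. For $f:X\to Y$ equivariant and a vertex $x$ of $X$, $-\Delta f(x)\in T_{f(x)}Y$ is the barycenter of the map $x'\mapsto\pi(f(x'))$ on the vertices $x'$ adjacent to $x$, with weights $m(x,x')$, that is, the point $b$ which minimizes $\sum_{x'}m(x,x')\,d(\pi(f(x')),b)^2$; $|-\Delta f(x)|$ is its distance to the apex, and $|-\Delta f|^2=\sum_z m(z)\,|-\Delta f(x)|^2$, where $x$ is a vertex above $z$. For a non-principal ultrafilter $\omega$ on $\mathbf N$, numbers $r_j>0$ and points $y_j\in Y$, the ultralimit $\lim_\omega(Y,r_jd,y_j)$ is the set of sequences $(x_j)$ in $Y$ with $r_jd(x_j,y_j)$ bounded, with the semi-distance $\lim_\omega r_jd(x_j,x'_j)$, modulo sequences at distance zero. It is an *asymptotic cone* of $Y$ if $r_j\to+\infty$ or $y_j\to\infty$. Then at least one of the following holds: 1. $\rho$ fixes a point of $Y$; 2. there is a non-constant $\rho$-equivariant harmonic map $X\to Y$; 3. there are an asymptotic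 cone $Y_\omega=\lim_\omega(Y,r_jd,y_j)$ of $Y$, an isometric action $\rho_\omega$ of $\Gamma$ on $Y_\omega$ that is induced by $\rho$ (for every $\gamma\in\Gamma$, $\rho_\omega(\gamma)$ maps the class of $(w_j)$ to the class of $(\rho(\gamma)w_j)$, which is again an admissible sequence), and a non-constant $\rho_\omega$-equivariant harmonic map $X\to Y_\omega$. Moreover, if there is a constant $C$ such that $E(f)\le C\,|-\Delta f|^2$ for every $\rho$-equivariant map $f:X\to Y$, then $\rho$ fixes a point of $Y$. -/

import Mathlib

open Filter Topology

noncomputable section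

namespace HarmonicMaps

/-! ## Geodesic `CAT(0)` spaces -/

/-- `s : [0,1] → Y` is a geodesic segment from `p` to `q`, parametrized at constant speed. -/
structure IsSegment {Y : Type*} [MetricSpace Y] (s : ℝ → Y) (p q : Y) : Prop where
  source : s 0 = p
  target : s 1 = q
  dist_eq : ∀ a ∈ Set.Icc (0 : ℝ) 1, ∀ b ∈ Set.Icc (0 : ℝ) 1,
    dist (s a) (s b) = |a - b| * dist p q

/-- Geodesic `CAT(0)` spaces: any two points are joined by a geodesic segment and, in every
geodesic triangle, the distance from a vertex to a point of the opposite side is at most the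
corresponding distance in the Euclidean triangle with the same side lengths. -/
class CAT0Space (Y : Type*) [MetricSpace Y] : Prop where
  exists_segment : ∀ p q : Y, ∃ s : ℝ → Y, IsSegment s p q
  comparison : ∀ (p q r : Y) (s : ℝ → Y), IsSegment s q r →
    ∀ p' q' r' : EuclideanSpace ℝ (Fin 2),
      dist p' q' = dist p q → dist p' r' = dist p r → dist q' r' = dist q r →
      ∀ t ∈ Set.Icc (0 : ℝ) 1, dist p (s t) ≤ dist p' ((1 - t) • q' + t • r')

/-! ## Tangent cones -/

/-- A constant speed geodesic issuing from `y`, defined for small nonnegative times (the values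
of `toFun` at other times are irrelevant). -/
structure GeodesicGerm {Y : Type*} [MetricSpace Y] (y : Y) where
  toFun : ℝ → Y
  map_zero : toFun 0 = y
  exists_speed : ∃ v ε : ℝ, 0 ≤ v ∧ 0 < ε ∧ ∀ a ∈ Set.Icc (0 : ℝ) ε, ∀ b ∈ Set.Icc (0 : ℝ) ε,
    dist (toFun a) (toFun b) = v * |a - b|

namespace GeodesicGerm

variable {Y : Type*} [MetricSpace Y] {y : Y}

/-- The distance `lim_{t → 0+} d(s(t), s'(t)) / t`. In a `CAT(0)` space the quotient is a monotone
function of `t`, so that the upper limit is a limit. -/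
def coneDist (s s' : GeodesicGerm y) : ℝ :=
  limsup (fun t : ℝ => dist (s.toFun t) (s'.toFun t) / t) (𝓝[>] 0)

theorem isBoundedUnder_quotient (s s' : GeodesicGerm y) :
    IsBoundedUnder (· ≤ ·) (𝓝[>] (0 : ℝ))
      (fun t : ℝ => dist (s.toFun t) (s'.toFun t) / t) := by
  obtain ⟨v, ε, -, hε, h⟩ := s.exists_speed
  obtain ⟨v', ε', -, hε', h'⟩ := s'.exists_speed
  refine ⟨v + v', ?_⟩
  rw [eventually_map]
  filter_upwards [Ioo_mem_nhdsGT (lt_min hε hε')] with t ht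
  have h0 : 0 < t := ht.1
  have h1 := h t ⟨h0.le, (ht.2.trans_le (min_le_left _ _)).le⟩ 0 ⟨le_rfl, hε.le⟩
  have h2 := h' t ⟨h0.le, (ht.2.trans_le (min_le_right _ _)).le⟩ 0 ⟨le_rfl, hε'.le⟩
  rw [s.map_zero, sub_zero, abs_of_pos h0] at h1
  rw [s'.map_zero, sub_zero, abs_of_pos h0] at h2
  rw [div_le_iff₀ h0]
  have := dist_triangle_right (s.toFun t) (s'.toFun t) y
  linarith

theorem isBoundedUnder_quotient_ge (s s' : GeodesicGerm y) :
    IsBoundedUnder (· ≥ ·) (𝓝[>] (0 : ℝ))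
      (fun t : ℝ => dist (s.toFun t) (s'.toFun t) / t) := by
  refine ⟨0, ?_⟩
  rw [eventually_map]
  filter_upwards [self_mem_nhdsWithin] with t ht
  exact div_nonneg dist_nonneg (le_of_lt ht)

instance : PseudoMetricSpace (GeodesicGerm y) where
  dist := coneDist
  dist_self s := by simp [coneDist]
  dist_comm s s' := by simp only [coneDist, dist_comm]
  dist_triangle s s' s'' := by
    have h1 := isBoundedUnder_quotient s s'
    have h2 := isBoundedUnder_quotient s' s''
    have g1 := isBoundedUnder_quotient_ge s s'
    have g2 := isBoundedUnder_quotient_ge s' s''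
    refine le_trans ?_ (limsup_add_le g1 h1 g2.isCoboundedUnder_le h2)
    refine limsup_le_limsup ?_ (isBoundedUnder_quotient_ge s s'').isCoboundedUnder_le
      (isBoundedUnder_le_add h1 h2)
    filter_upwards [self_mem_nhdsWithin] with t ht
    have h0 : (0 : ℝ) < t := ht
    simp only [Pi.add_apply]
    rw [← add_div]
    exact div_le_div_of_nonneg_right (dist_triangle _ _ _) h0.le

end GeodesicGerm

/-- The tangent cone `T_y Y`: constant speed geodesics issuing from `y` with the distance
`lim d(s(t), s'(t)) / t`, geodesics at distance zero being identified, and completed. -/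
abbrev TangentCone {Y : Type*} [MetricSpace Y] (y : Y) : Type _ :=
  UniformSpace.Completion (GeodesicGerm y)

/-- The apex of the tangent cone: the class of the constant geodesic. -/
def TangentCone.apex {Y : Type*} [MetricSpace Y] (y : Y) : TangentCone y :=
  ((⟨fun _ => y, rfl, 0, 1, le_rfl, one_pos, by simp⟩ : GeodesicGerm y) :
    UniformSpace.Completion (GeodesicGerm y))

/-- The geodesic segment from `y` to `y'`, parametrized at constant speed by `[0,1]`, as a
geodesic issuing from `y`. -/
def segmentGerm {Y : Type*} [MetricSpace Y] [CAT0Space Y] (y y' : Y) : GeodesicGerm y where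
  toFun := (CAT0Space.exists_segment y y').choose
  map_zero := (CAT0Space.exists_segment y y').choose_spec.source
  exists_speed := ⟨dist y y', 1, dist_nonneg, one_pos, fun a ha b hb => by
    rw [(CAT0Space.exists_segment y y').choose_spec.dist_eq a ha b hb, mul_comm]⟩

/-- The projection `π : Y → T_y Y`. -/
def TangentCone.proj {Y : Type*} [MetricSpace Y] [CAT0Space Y] (y y' : Y) : TangentCone y :=
  (segmentGerm y y' : UniformSpace.Completion (GeodesicGerm y))

/-- `b` is a barycenter of the map `g`, defined on the finite set `s` with weights `w`: it
minimizes the weighted sum of the squared distances to the values of `g`. -/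
def IsBarycenter {ι T : Type*} [MetricSpace T] (s : Finset ι) (w : ι → ℝ) (g : ι → T) (b : T) :
    Prop :=
  ∀ b' : T, ∑ i ∈ s, w i * dist (g i) b ^ 2 ≤ ∑ i ∈ s, w i * dist (g i) b' ^ 2

/-! ## Simplicial complexes, weights, universal coverings -/

/-- A (positive) weight on a finite simplicial complex: the weight of a simplex is the sum of the
weights of the simplices of the next dimension that contain it, except for maximal simplices, whose
weights are not constrained. -/
structure Weight {W : Type*} [Fintype W] (K : AbstractSimplicialComplex W) where
  toFun : Finset W → ℝ
  pos : ∀ σ ∈ K.faces, 0 < toFun σ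
  eq_sum : ∀ σ ∈ K.faces, (∃ τ ∈ K.faces, σ ⊂ τ) →
    toFun σ = ∑ᶠ τ ∈ {τ : Finset W | τ ∈ K.faces ∧ σ ⊆ τ ∧ τ.card = σ.card + 1}, toFun τ

/-- The geometric realization of a simplicial complex: finitely supported barycentric coordinates
whose support is a simplex. -/
def Realization {V : Type*} (K : AbstractSimplicialComplex V) : Type _ :=
  {a : V →₀ ℝ // (∀ v, 0 ≤ a v) ∧ (a.sum fun _ x => x) = 1 ∧ a.support ∈ K.faces}

/-- The weak topology: the finest topology for which the inclusions of all closed simplices, each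
with its Euclidean topology (pointwise convergence of the barycentric coordinates), are
continuous. -/
instance {V : Type*} (K : AbstractSimplicialComplex V) : TopologicalSpace (Realization K) :=
  ⨆ σ : K.faces, TopologicalSpace.coinduced
    (Subtype.val : {a : Realization K // a.1.support ⊆ σ.1} → Realization K)
    (TopologicalSpace.induced (fun a v => a.1.1 v) (inferInstance : TopologicalSpace (V → ℝ)))

/-- A universal covering of the simplicial complex `Z`, with vertex set `V`, on which the group `Γ`
acts as the group of deck transformations; as the covering is simply connected, `Γ` is the
fundamental group of `Z`. -/
structure UniversalCovering {W : Type*} [DecidableEq W] (Z : AbstractSimplicialComplex W)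
    (Γ : Type*) [Group Γ] (V : Type*) [DecidableEq V] [MulAction Γ V] where
  /-- the simplicial complex `X` -/
  complex : AbstractSimplicialComplex V
  /-- the covering map on vertices -/
  proj : V → W
  proj_surjective : Function.Surjective proj
  /-- the covering map is simplicial, and maps the star of every vertex isomorphically onto the
  star of its image -/
  bijOn_star : ∀ v : V, Set.BijOn (Finset.image proj)
    {σ | σ ∈ complex.faces ∧ v ∈ σ} {τ | τ ∈ Z.faces ∧ proj v ∈ τ}
  simplyConnected : SimplyConnectedSpace (Realization complex)
  smul_mem_faces : ∀ (γ : Γ), ∀ σ ∈ complex.faces, σ.image (fun v => γ • v) ∈ complex.faces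
  proj_smul : ∀ (γ : Γ) (v : V), proj (γ • v) = proj v
  /-- simple transitivity on the fibres -/
  existsUnique_smul : ∀ v v' : V, proj v = proj v' → ∃! γ : Γ, γ • v = v'

namespace UniversalCovering

variable {W : Type*} [Fintype W] [DecidableEq W] {Z : AbstractSimplicialComplex W}
  {Γ : Type*} [Group Γ] {V : Type*} [DecidableEq V] [MulAction Γ V]

theorem finite_link (X : UniversalCovering Z Γ V) (x : V) :
    {x' : V | x' ≠ x ∧ ({x, x'} : Finset V) ∈ X.complex.faces}.Finite := by
  refine Set.Finite.of_finite_image (f := fun x' => Finset.image X.proj {x, x'})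
    (Set.toFinite _) ?_
  intro a ha b hb hab
  have h : ({x, a} : Finset V) = {x, b} :=
    (X.bijOn_star x).injOn ⟨ha.2, by simp⟩ ⟨hb.2, by simp⟩ hab
  have : a ∈ ({x, b} : Finset V) := h ▸ (by simp)
  simpa [ha.1] using this

/-- The vertices of the link of the vertex `x` in `X`, i.e. the neighbours of `x`. -/
def link (X : UniversalCovering Z Γ V) (x : V) : Finset V := (X.finite_link x).toFinset

/-- A vertex of `X` above the vertex `z` of `Z`. -/
def lift (X : UniversalCovering Z Γ V) (z : W) : V := Function.surjInv X.proj_surjective z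

/-- The weight of the edge of `Z` below the edge `{x, x'}` of `X`; as a function of the vertex
`x'` of the link of `x`, this is the weight that the link inherits. -/
def edgeWeight (X : UniversalCovering Z Γ V) (m : Weight Z) (x x' : V) : ℝ :=
  m.toFun {X.proj x, X.proj x'}

/-- `f : X → Y` is equivariant with respect to the isometric action `ρ`. -/
def IsEquivariant (_ : UniversalCovering Z Γ V) {Y : Type*} [MetricSpace Y] (ρ : Γ →* (Y ≃ᵢ Y))
    (f : V → Y) : Prop :=
  ∀ (γ : Γ) (x : V), f (γ • x) = ρ γ (f x)

/-- The distance between equivariant maps. -/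
def mapDist (X : UniversalCovering Z Γ V) (m : Weight Z) {Y : Type*} [MetricSpace Y]
    (f g : V → Y) : ℝ :=
  √(∑ z : W, m.toFun {z} * dist (f (X.lift z)) (g (X.lift z)) ^ 2)

/-- The energy of an equivariant map: `1/2 ∑_z ∑_{z' ∼ z} m(z,z') d(f(c), f(c'))²`, where `(c,c')`
is an edge of `X` above `(z,z')`. -/
def energy (X : UniversalCovering Z Γ V) (m : Weight Z) {Y : Type*} [MetricSpace Y]
    (f : V → Y) : ℝ :=
  1 / 2 * ∑ z : W, ∑ c' ∈ X.link (X.lift z),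
    X.edgeWeight m (X.lift z) c' * dist (f (X.lift z)) (f c') ^ 2

/-- An equivariant map is harmonic if it is a local minimum of the energy among equivariant
maps. -/
def IsHarmonic (X : UniversalCovering Z Γ V) (m : Weight Z) {Y : Type*} [MetricSpace Y]
    (ρ : Γ →* (Y ≃ᵢ Y)) (f : V → Y) : Prop :=
  X.IsEquivariant ρ f ∧ ∃ ε > 0, ∀ g : V → Y, X.IsEquivariant ρ g → X.mapDist m f g < ε →
    X.energy m f ≤ X.energy m g

open Classical in
/-- `-Δf(x)`, the barycenter of `π ∘ f` restricted to the link of `x`, a point of the tangent cone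
of `Y` at `f(x)`. It exists and is unique when `Y` is `CAT(0)` and the link is nonempty. -/
def negLaplacian (X : UniversalCovering Z Γ V) (m : Weight Z) {Y : Type*} [MetricSpace Y]
    [CAT0Space Y] (f : V → Y) (x : V) : TangentCone (f x) :=
  if h : ∃ b, IsBarycenter (X.link x) (X.edgeWeight m x)
      (fun x' => TangentCone.proj (f x) (f x')) b
  then h.choose else TangentCone.apex (f x)

/-- `|-Δf|² = ∑_z m(z) |-Δf(x)|²`, with `x` above `z` and `|-Δf(x)|` the distance to the apex. -/
def normSqLaplacian (X : UniversalCovering Z Γ V) (m : Weight Z) {Y : Type*} [MetricSpace Y]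
    [CAT0Space Y] (f : V → Y) : ℝ :=
  ∑ z : W, m.toFun {z} *
    dist (X.negLaplacian m f (X.lift z)) (TangentCone.apex (f (X.lift z))) ^ 2

end UniversalCovering

/-! ## Ultralimits and asymptotic cones -/

/-- Sequences of points `x j ∈ Y j` whose distance to the base points `y j` stays bounded. -/
structure BoundedSeq (ω : Ultrafilter ℕ) (Y : ℕ → Type*) [∀ j, MetricSpace (Y j)]
    (y : ∀ j, Y j) where
  seq : ∀ j, Y j
  bounded : ∃ C : ℝ, ∀ j, dist (seq j) (y j) ≤ C

namespace BoundedSeq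

variable {ω : Ultrafilter ℕ} {Y : ℕ → Type*} [∀ j, MetricSpace (Y j)] {y : ∀ j, Y j}

/-- The semi-distance `lim_ω d(x_j, x'_j)`. -/
def ultraDist (x x' : BoundedSeq ω Y y) : ℝ :=
  limUnder (ω : Filter ℕ) (fun j => dist (x.seq j) (x'.seq j))

theorem tendsto_ultraDist (x x' : BoundedSeq ω Y y) :
    Tendsto (fun j => dist (x.seq j) (x'.seq j)) ω (𝓝 (ultraDist x x')) := by
  obtain ⟨C, hC⟩ := x.bounded
  obtain ⟨C', hC'⟩ := x'.bounded
  refine tendsto_nhds_limUnder ?_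
  have hmem : ∀ j, dist (x.seq j) (x'.seq j) ∈ Set.Icc (0 : ℝ) (C + C') := fun j =>
    ⟨dist_nonneg, (dist_triangle_right _ _ (y j)).trans (add_le_add (hC j) (hC' j))⟩
  obtain ⟨l, -, hl⟩ := (isCompact_Icc : IsCompact (Set.Icc (0 : ℝ) (C + C'))).ultrafilter_le_nhds
    (ω.map fun j => dist (x.seq j) (x'.seq j))
    (by
      rw [Ultrafilter.coe_map, le_principal_iff, mem_map]
      exact Eventually.of_forall hmem)
  exact ⟨l, hl⟩

instance : PseudoMetricSpace (BoundedSeq ω Y y) where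
  dist := ultraDist
  dist_self x := tendsto_nhds_unique (tendsto_ultraDist x x) (by simp)
  dist_comm x x' := by simp only [ultraDist, dist_comm]
  dist_triangle x x' x'' :=
    le_of_tendsto_of_tendsto' (tendsto_ultraDist x x'')
      ((tendsto_ultraDist x x').add (tendsto_ultraDist x' x'')) fun _ => dist_triangle _ _ _

end BoundedSeq

/-- The ultralimit `lim_ω (Y_j, y_j)`: bounded sequences up to semi-distance zero. -/
abbrev Ultralimit (ω : Ultrafilter ℕ) (Y : ℕ → Type*) [∀ j, MetricSpace (Y j)]
    (y : ∀ j, Y j) : Type _ :=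
  SeparationQuotient (BoundedSeq ω Y y)

/-- The homothetic space `(Y, r d)`. -/
structure Rescaled (r : Set.Ioi (0 : ℝ)) (Y : Type*) where
  point : Y

instance (r : Set.Ioi (0 : ℝ)) (Y : Type*) [MetricSpace Y] : MetricSpace (Rescaled r Y) where
  dist a b := r * dist a.point b.point
  dist_self a := by simp
  dist_comm a b := by simp only [dist_comm]
  dist_triangle a b c := by
    rw [← mul_add]
    exact mul_le_mul_of_nonneg_left (dist_triangle _ _ _) (le_of_lt r.2)
  eq_of_dist_eq_zero {a b} h := by
    have h0 : dist a.point b.point = 0 := (mul_eq_zero.mp h).resolve_left (ne_of_gt r.2)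
    cases a
    cases b
    congr
    exact dist_eq_zero.mp h0

/-- The ultralimit of the homothetic spaces `(Y, r_j d, y_j)`. It is called an asymptotic cone of
`Y` when `IsAsymptoticConeData` holds. -/
abbrev RescaledLimit (ω : Ultrafilter ℕ) (r : ℕ → Set.Ioi (0 : ℝ)) (Y : Type*) [MetricSpace Y]
    (y : ℕ → Y) : Type _ :=
  Ultralimit ω (fun j => Rescaled (r j) Y) (fun j => ⟨y j⟩)

/-- The ultrafilter is non-principal, and `r_j → +∞` or `y_j → ∞`. -/
def IsAsymptoticConeData (ω : Ultrafilter ℕ) (r : ℕ → Set.Ioi (0 : ℝ)) {Y : Type*}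
    [MetricSpace Y] (y : ℕ → Y) : Prop :=
  (ω : Filter ℕ) ≤ cofinite ∧
    (Tendsto (fun j => (r j : ℝ)) atTop atTop ∨ Tendsto y atTop (Bornology.cobounded Y))

/-- The isometric action `ρω` on the ultralimit is induced by `ρ`: an element `γ` maps the class
of a bounded sequence `(w_j)` to the class of `(γ w_j)`, which is again a bounded sequence. -/
def IsInducedAction {Γ : Type*} [Group Γ] {Y : Type*} [MetricSpace Y] (ρ : Γ →* (Y ≃ᵢ Y))
    {ω : Ultrafilter ℕ} {r : ℕ → Set.Ioi (0 : ℝ)} {y : ℕ → Y}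
    (ρω : Γ →* (RescaledLimit ω r Y y ≃ᵢ RescaledLimit ω r Y y)) : Prop :=
  ∀ (γ : Γ) (w : BoundedSeq ω (fun j => Rescaled (r j) Y) (fun j => ⟨y j⟩)),
    ∃ w' : BoundedSeq ω (fun j => Rescaled (r j) Y) (fun j => ⟨y j⟩),
      (∀ j, (w'.seq j).point = ρ γ (w.seq j).point) ∧
        ρω γ (SeparationQuotient.mk w) = SeparationQuotient.mk w'

end HarmonicMaps

end

open HarmonicMaps

open HarmonicMaps

/-! An equivariant map is determined by its values on one lift of each vertex of `Z`, so the space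
of equivariant maps is the complete space `W → Y` (with the sup distance). There the energy is
replaced by its square root F, which is continuous, nonnegative and homogeneous of degree one when
the metric of `Y` is rescaled. Call h ε-critical if F(h) ≤ F(g) + ε d(h,g) for every g. This
condition is invariant under rescaling, and Ekeland's principle (`exists_forall_le_add_mul_dist`)
provides ε-critical maps for every ε > 0. Since `X` is connected, F(h) bounds the distances between
the values of h (`exists_dist_le_sqrt_energy`); in particular F never vanishes unless `ρ` has a
fixed point.

Suppose that there is no fixed point. If, for some ε, the ε-critical maps have bounded value at a
base vertex, then they form a bounded set which contains almost minimizers of F. The energy is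
convex and `Y` is uniformly convex, so F attains its minimum (`exists_minimizer`), and a minimizer
is a non-constant harmonic map. Otherwise there are (1/(j+1))-critical maps whose base values leave
every bounded set. After rescaling by the inverse of F, their ultralimit has energy 1 and minimizes
the energy, because the error in the critical inequality tends to 0
(`exists_isHarmonic_rescaledLimit`); its target is an asymptotic cone since the base points go to
infinity.

For the last assertion, moving one value of an ε-critical map along a geodesic germ, and using the
`CAT(0)` first variation inequality, shows that the norm of its Laplacian is at most a constant
times ε F (`dist_negLaplacian_le`). For ε small this contradicts E ≤ C |-Δf|² unless F = 0, that is,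
unless there is a fixed point. -/

namespace HarmonicMaps

namespace UniversalCovering

variable {W : Type*} [DecidableEq W] {Z : AbstractSimplicialComplex W}
  {Γ : Type*} [Group Γ] {V : Type*} [DecidableEq V] [MulAction Γ V]
  {Y : Type*} [MetricSpace Y]

/-! ### Equivariant maps are determined by their values on the lifts -/

theorem proj_lift (X : UniversalCovering Z Γ V) (z : W) : X.proj (X.lift z) = z :=
  Function.surjInv_eq X.proj_surjective z

theorem smul_vertex_injective (X : UniversalCovering Z Γ V) {γ γ' : Γ} {v : V}
    (h : γ • v = γ' • v) : γ = γ' :=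
  (X.existsUnique_smul v (γ' • v) (X.proj_smul γ' v).symm).unique h rfl

/-- The deck transformation which maps the chosen lift of `X.proj v` to `v`. -/
noncomputable def deck (X : UniversalCovering Z Γ V) (v : V) : Γ :=
  (X.existsUnique_smul (X.lift (X.proj v)) v (X.proj_lift _)).choose

theorem deck_smul_lift (X : UniversalCovering Z Γ V) (v : V) :
    X.deck v • X.lift (X.proj v) = v :=
  (X.existsUnique_smul (X.lift (X.proj v)) v (X.proj_lift _)).choose_spec.1

theorem deck_smul (X : UniversalCovering Z Γ V) (γ : Γ) (v : V) :
    X.deck (γ • v) = γ * X.deck v := by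
  apply X.smul_vertex_injective (v := X.lift (X.proj v))
  rw [mul_smul, deck_smul_lift]
  have := X.deck_smul_lift (γ • v)
  rwa [X.proj_smul] at this

theorem deck_lift (X : UniversalCovering Z Γ V) (z : W) : X.deck (X.lift z) = 1 := by
  apply X.smul_vertex_injective (v := X.lift z)
  have := X.deck_smul_lift (X.lift z)
  rw [X.proj_lift] at this
  rw [this, one_smul]

/-- The equivariant map with given values on the chosen lifts. -/
noncomputable def extend (X : UniversalCovering Z Γ V) (ρ : Γ →* (Y ≃ᵢ Y)) (h : W → Y) (v : V) : Y :=
  ρ (X.deck v) (h (X.proj v))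

theorem isEquivariant_extend (X : UniversalCovering Z Γ V) (ρ : Γ →* (Y ≃ᵢ Y)) (h : W → Y) :
    X.IsEquivariant ρ (X.extend ρ h) := by
  intro γ x
  simp only [extend, X.deck_smul, X.proj_smul, map_mul]
  rfl

theorem extend_lift (X : UniversalCovering Z Γ V) (ρ : Γ →* (Y ≃ᵢ Y)) (h : W → Y) (z : W) :
    X.extend ρ h (X.lift z) = h z := by
  simp only [extend, X.deck_lift, X.proj_lift, map_one]
  rfl

theorem continuous_extend (X : UniversalCovering Z Γ V) (ρ : Γ →* (Y ≃ᵢ Y)) (v : V) :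
    Continuous fun h : W → Y => X.extend ρ h v :=
  (ρ (X.deck v)).continuous.comp (continuous_apply _)

theorem IsEquivariant.extend_eq {X : UniversalCovering Z Γ V} {ρ : Γ →* (Y ≃ᵢ Y)} {f : V → Y}
    (hf : X.IsEquivariant ρ f) : X.extend ρ (fun z => f (X.lift z)) = f := by
  funext v
  rw [extend, ← hf, X.deck_smul_lift]

theorem IsEquivariant.dist_smul {X : UniversalCovering Z Γ V} {ρ : Γ →* (Y ≃ᵢ Y)} {f g : V → Y}
    (hf : X.IsEquivariant ρ f) (hg : X.IsEquivariant ρ g) (γ : Γ) (x x' : V) :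
    dist (f (γ • x)) (g (γ • x')) = dist (f x) (g x') := by
  rw [hf, hg, (ρ γ).dist_eq]

theorem nonempty_vertices (X : UniversalCovering Z Γ V) : Nonempty V := by
  have := X.simplyConnected
  obtain ⟨a⟩ : Nonempty (Realization X.complex) := inferInstance
  obtain ⟨w, -⟩ := (X.complex.isRelLowerSet_faces a.2.2.2).1
  exact ⟨w⟩

variable [Fintype W]

/-! ### Links and weights -/

theorem mem_link (X : UniversalCovering Z Γ V) {x x' : V} :
    x' ∈ X.link x ↔ x' ≠ x ∧ ({x, x'} : Finset V) ∈ X.complex.faces := by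
  simp [link]

theorem mem_link_comm (X : UniversalCovering Z Γ V) {x x' : V} :
    x' ∈ X.link x ↔ x ∈ X.link x' := by
  rw [mem_link, mem_link, Finset.pair_comm, ne_comm]

theorem smul_mem_link (X : UniversalCovering Z Γ V) (γ : Γ) {x x' : V} (h : x' ∈ X.link x) :
    γ • x' ∈ X.link (γ • x) := by
  rw [mem_link] at h ⊢
  refine ⟨fun h' => h.1 (MulAction.injective γ h'), ?_⟩
  simpa [Finset.image_insert] using X.smul_mem_faces γ _ h.2

theorem proj_pair_mem_faces (X : UniversalCovering Z Γ V) {x x' : V} (h : x' ∈ X.link x) :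
    ({X.proj x, X.proj x'} : Finset W) ∈ Z.faces := by
  have := ((X.bijOn_star x).mapsTo ⟨(X.mem_link.1 h).2, by simp⟩).1
  simpa [Finset.image_insert] using this

/-- Otherwise the edge and its vertex x, both in the star of x, would have the same image, against
injectivity on stars. Hence changing a map over one vertex of `Z` leaves its values at the
neighbours unchanged. -/
theorem proj_ne_of_mem_link (X : UniversalCovering Z Γ V) {x x' : V} (h : x' ∈ X.link x) :
    X.proj x' ≠ X.proj x := by
  intro h'
  have h1 : ({x, x'} : Finset V) = {x} :=
    (X.bijOn_star x).injOn ⟨(X.mem_link.1 h).2, by simp⟩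
      ⟨X.complex.singleton_mem x, by simp⟩ (by simp [Finset.image_insert, h'])
  have h2 : x' ∈ ({x} : Finset V) := h1 ▸ (by simp)
  exact (X.mem_link.1 h).1 (by simpa using h2)

theorem edgeWeight_pos (X : UniversalCovering Z Γ V) (m : Weight Z) {x x' : V}
    (h : x' ∈ X.link x) : 0 < X.edgeWeight m x x' :=
  m.pos _ (X.proj_pair_mem_faces h)

theorem edgeWeight_comm (X : UniversalCovering Z Γ V) (m : Weight Z) (x x' : V) :
    X.edgeWeight m x x' = X.edgeWeight m x' x := by
  simp [edgeWeight, Finset.pair_comm]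

theorem edgeWeight_smul (X : UniversalCovering Z Γ V) (m : Weight Z) (γ : Γ) (x x' : V) :
    X.edgeWeight m (γ • x) (γ • x') = X.edgeWeight m x x' := by
  simp [edgeWeight, X.proj_smul]

/-! ### Connectedness -/

/-- A set of vertices of `X` which is stable under adjacency is everything as soon as it is
nonempty. -/
theorem link_induction (X : UniversalCovering Z Γ V) {P : V → Prop} {x : V} (hx : P x)
    (hP : ∀ a, ∀ b ∈ X.link a, P a → P b) (x' : V) : P x' := by
  classical
  have key : ∀ σ ∈ X.complex.faces, ∀ a ∈ σ, ∀ b ∈ σ, P a → P b := by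
    intro σ hσ a ha b hb hPa
    by_cases hab : b = a
    · exact hab ▸ hPa
    refine hP a b (X.mem_link.2 ⟨hab, ?_⟩) hPa
    refine (X.complex.isRelLowerSet_faces hσ).2 ?_ (by simp)
    intro c hc
    rcases Finset.mem_insert.1 hc with rfl | hc
    · exact ha
    · rw [Finset.mem_singleton.1 hc]; exact hb
  -- By `key`, this indicator is constant on each closed simplex, hence continuous for the weak
  -- topology, hence constant since the realization is connected.
  let g : Realization X.complex → Bool := fun a => decide (∃ v ∈ a.1.support, P v)
  have hg : Continuous g := by
    rw [continuous_iSup_dom]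
    intro σ
    rw [continuous_coinduced_dom]
    have hconst : (g ∘ (Subtype.val : {a : Realization X.complex // a.1.support ⊆ σ.1} →
        Realization X.complex)) = fun _ => decide (∃ v ∈ σ.1, P v) := by
      funext a
      simp only [g, Function.comp]
      refine decide_eq_decide.2 ⟨fun ⟨v, hv, h⟩ => ⟨v, a.2 hv, h⟩, fun ⟨v, hv, h⟩ => ?_⟩
      obtain ⟨w, hw⟩ := (X.complex.isRelLowerSet_faces a.1.2.2.2).1
      exact ⟨w, hw, key σ.1 σ.2 v hv w (a.2 hw) h⟩
    rw [hconst]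
    exact @continuous_const _ _ (_) _ _
  let pt : V → Realization X.complex := fun v => ⟨Finsupp.single v 1, by
    refine ⟨fun w => ?_, by simp, ?_⟩
    · rw [Finsupp.single_apply]; split_ifs <;> norm_num
    · rw [Finsupp.support_single _ one_ne_zero]
      exact X.complex.singleton_mem v⟩
  have hpt : ∀ v, g (pt v) = decide (P v) := by
    intro v
    simp only [g, pt]
    refine decide_eq_decide.2 ?_
    rw [Finsupp.support_single _ one_ne_zero]
    simp
  have := X.simplyConnected
  have h := PreconnectedSpace.constant (inferInstance) hg (x := pt x) (y := pt x')
  rw [hpt, hpt] at h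
  exact (decide_eq_decide.1 h).1 hx

/-- Sums over oriented edges may be computed with the edges reversed. -/
theorem sum_link_comm (X : UniversalCovering Z Γ V) {φ : V → V → ℝ}
    (hφ : ∀ (γ : Γ) x x', φ (γ • x) (γ • x') = φ x x') :
    ∑ z : W, ∑ c ∈ X.link (X.lift z), φ (X.lift z) c =
      ∑ z : W, ∑ c ∈ X.link (X.lift z), φ c (X.lift z) := by
  rw [Finset.sum_sigma', Finset.sum_sigma']
  -- The involution on oriented edges: reverse the edge, then translate it so that its new origin is
  -- the chosen lift.
  have hmem : ∀ a ∈ Finset.univ.sigma (fun z : W => X.link (X.lift z)),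
      (⟨X.proj a.2, (X.deck a.2)⁻¹ • X.lift a.1⟩ : Σ _ : W, V) ∈
        Finset.univ.sigma (fun z : W => X.link (X.lift z)) := by
    rintro ⟨z, c⟩ h
    simp only [Finset.mem_sigma, Finset.mem_univ, true_and] at h ⊢
    have := X.smul_mem_link (X.deck c)⁻¹ (X.mem_link_comm.1 h)
    rwa [show (X.deck c)⁻¹ • c = X.lift (X.proj c) from
      inv_smul_eq_iff.2 (X.deck_smul_lift c).symm] at this
  have hinv : ∀ a : Σ _ : W, V, (⟨X.proj ((X.deck a.2)⁻¹ • X.lift a.1),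
      (X.deck ((X.deck a.2)⁻¹ • X.lift a.1))⁻¹ • X.lift (X.proj a.2)⟩ : Σ _ : W, V) = a := by
    rintro ⟨z, c⟩
    simp only [X.proj_smul, X.proj_lift, X.deck_smul, X.deck_lift, mul_one, inv_inv,
      X.deck_smul_lift]
  refine Finset.sum_bij' (fun a _ => ⟨X.proj a.2, (X.deck a.2)⁻¹ • X.lift a.1⟩)
    (fun a _ => ⟨X.proj a.2, (X.deck a.2)⁻¹ • X.lift a.1⟩) hmem hmem
    (fun a _ => hinv a) (fun a _ => hinv a) ?_
  rintro ⟨z, c⟩ -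
  simp only
  rw [← hφ (X.deck c)⁻¹ (X.lift z) c, show (X.deck c)⁻¹ • c = X.lift (X.proj c) from
      inv_smul_eq_iff.2 (X.deck_smul_lift c).symm]

/-! ### The energy controls distances -/

theorem energy_nonneg (X : UniversalCovering Z Γ V) (m : Weight Z) (f : V → Y) :
    0 ≤ X.energy m f :=
  mul_nonneg (by norm_num) <| Finset.sum_nonneg fun _ _ => Finset.sum_nonneg fun _ hc =>
    mul_nonneg (X.edgeWeight_pos m hc).le (sq_nonneg _)

theorem edgeWeight_mul_dist_sq_le (X : UniversalCovering Z Γ V) (m : Weight Z)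
    {ρ : Γ →* (Y ≃ᵢ Y)} {f : V → Y} (hf : X.IsEquivariant ρ f) {x x' : V}
    (h : x' ∈ X.link x) : X.edgeWeight m x x' * dist (f x) (f x') ^ 2 ≤ 2 * X.energy m f := by
  have hx : (X.deck x)⁻¹ • x = X.lift (X.proj x) :=
    inv_smul_eq_iff.2 (X.deck_smul_lift x).symm
  have h' := X.smul_mem_link (X.deck x)⁻¹ h
  rw [← X.edgeWeight_smul m (X.deck x)⁻¹, ← hf.dist_smul hf (X.deck x)⁻¹]
  rw [hx] at h' ⊢
  have h1 := Finset.single_le_sum (f := fun c => X.edgeWeight m (X.lift (X.proj x)) c *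
    dist (f (X.lift (X.proj x))) (f c) ^ 2)
    (fun c hc => mul_nonneg (X.edgeWeight_pos m hc).le (sq_nonneg _)) h'
  have h2 := Finset.single_le_sum (f := fun z => ∑ c ∈ X.link (X.lift z),
    X.edgeWeight m (X.lift z) c * dist (f (X.lift z)) (f c) ^ 2)
    (fun z _ => Finset.sum_nonneg fun c hc =>
      mul_nonneg (X.edgeWeight_pos m hc).le (sq_nonneg _)) (Finset.mem_univ (X.proj x))
  rw [energy]
  linarith

/-- The distance between the images of two given vertices is controlled by the energy. -/
theorem exists_dist_le_sqrt_energy (X : UniversalCovering Z Γ V) (m : Weight Z) (x x' : V) :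
    ∃ C : ℝ, 0 ≤ C ∧ ∀ (ρ : Γ →* (Y ≃ᵢ Y)) (f : V → Y),
      X.IsEquivariant ρ f → dist (f x) (f x') ≤ C * √(X.energy m f) := by
  refine X.link_induction (P := fun x' => ∃ C : ℝ, 0 ≤ C ∧ ∀ (ρ : Γ →* (Y ≃ᵢ Y))
    (f : V → Y), X.IsEquivariant ρ f → dist (f x) (f x') ≤ C * √(X.energy m f)) (x := x)
    ⟨0, le_rfl, by simp⟩ ?_ x'
  rintro a b hb ⟨C, hC, h⟩
  have hw := X.edgeWeight_pos m hb
  refine ⟨C + √(2 / X.edgeWeight m a b), by positivity, fun ρ f hf => ?_⟩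
  have h1 : dist (f a) (f b) ≤ √(2 / X.edgeWeight m a b) * √(X.energy m f) := by
    rw [← Real.sqrt_mul (by positivity)]
    apply Real.le_sqrt_of_sq_le
    rw [div_mul_eq_mul_div, le_div_iff₀ hw, mul_comm]
    exact X.edgeWeight_mul_dist_sq_le m hf hb
  rw [add_mul]
  exact (dist_triangle _ _ _).trans (add_le_add (h ρ f hf) h1)

theorem energy_eq_zero_of_const (X : UniversalCovering Z Γ V) (m : Weight Z) {f : V → Y}
    (h : ∀ x x', f x = f x') : X.energy m f = 0 := by
  simp [energy, fun x x' => dist_eq_zero.2 (h x x')]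

/-- Zero energy forces f to be constant by the preceding distance bound, and equivariance makes the
constant value a fixed point. -/
theorem exists_fixed_point_of_energy_eq_zero (X : UniversalCovering Z Γ V) (m : Weight Z)
    {ρ : Γ →* (Y ≃ᵢ Y)} {f : V → Y} (hf : X.IsEquivariant ρ f) (h : X.energy m f = 0) :
    ∃ y : Y, ∀ γ : Γ, ρ γ y = y := by
  obtain ⟨x⟩ := X.nonempty_vertices
  refine ⟨f x, fun γ => ?_⟩
  obtain ⟨C, -, hC⟩ := X.exists_dist_le_sqrt_energy (Y := Y) m (γ • x) x
  have := hC ρ f hf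
  rw [h, Real.sqrt_zero, mul_zero] at this
  rw [← hf, dist_le_zero.1 this]

end UniversalCovering

end HarmonicMaps

/-! ### Ekeland's variational principle -/

/-- A form of Ekeland's variational principle. -/
theorem exists_forall_le_add_mul_dist {M : Type*} [MetricSpace M] [CompleteSpace M] [Nonempty M]
    {F : M → ℝ} (hF : Continuous F) (h0 : ∀ x, 0 ≤ F x) {ε : ℝ} (hε : 0 < ε) :
    ∃ x, ∀ y, F x ≤ F y + ε * dist x y := by
  -- The relation F y + ε d(x,y) ≤ F x is a partial order. Below x, choose y whose value is within
  -- (1/2)^n of the infimum.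
  have step : ∀ (n : ℕ) (x : M), ∃ y, F y + ε * dist x y ≤ F x ∧
      ∀ w, F w + ε * dist x w ≤ F x → F y ≤ F w + (1 / 2) ^ n := by
    intro n x
    let S : Set ℝ := F '' {w | F w + ε * dist x w ≤ F x}
    have hne : S.Nonempty := ⟨F x, x, by simp, rfl⟩
    have hbdd : BddBelow S := ⟨0, by rintro _ ⟨w, -, rfl⟩; exact h0 w⟩
    obtain ⟨_, ⟨y, hy, rfl⟩, hlt⟩ := exists_lt_of_csInf_lt hne
      (lt_add_of_pos_right (sInf S) (by positivity : (0 : ℝ) < (1 / 2) ^ n))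
    exact ⟨y, hy, fun w hw => hlt.le.trans (by gcongr; exact csInf_le hbdd ⟨w, hw, rfl⟩)⟩
  choose next hnext hmin using step
  obtain ⟨x0⟩ := ‹Nonempty M›
  let u : ℕ → M := fun n => Nat.rec x0 (fun n x => next n x) n
  have hu : ∀ n, u (n + 1) = next n (u n) := fun n => rfl
  have hdist : ∀ n m, n ≤ m → F (u m) + ε * dist (u n) (u m) ≤ F (u n) := by
    intro n m hnm
    induction m, hnm using Nat.le_induction with
    | base => simp
    | succ m _ ih =>
      have h1 := hnext m (u m)
      rw [← hu] at h1
      have h2 := mul_le_mul_of_nonneg_left (dist_triangle (u n) (u m) (u (m + 1))) hε.le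
      linarith
  have hanti : Antitone (F ∘ u) := fun n m hnm => by
    have := hdist n m hnm
    have := mul_nonneg hε.le (dist_nonneg (x := u n) (y := u m))
    simp only [Function.comp]
    linarith
  have hlim := tendsto_atTop_ciInf hanti ⟨0, by rintro _ ⟨n, rfl⟩; exact h0 _⟩
  set L := ⨅ n, (F ∘ u) n
  have hL : ∀ m, L ≤ F (u m) := fun m => hanti.le_of_tendsto hlim m
  have hcau : CauchySeq u := by
    refine cauchySeq_of_le_tendsto_0' (fun n => (F (u n) - L) / ε) (fun n m hnm => ?_) ?_
    · rw [le_div_iff₀ hε]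
      linarith [hdist n m hnm, hL m]
    · simpa using (hlim.sub_const L).div_const ε
  obtain ⟨x, hx⟩ := cauchySeq_tendsto_of_complete hcau
  have hFx : Tendsto (fun n => F (u n)) atTop (𝓝 (F x)) := (hF.tendsto x).comp hx
  have hdx : ∀ n, F x + ε * dist (u n) x ≤ F (u n) := fun n =>
    le_of_tendsto (hFx.add ((tendsto_const_nhds.dist hx).const_mul ε))
      (eventually_atTop.2 ⟨n, fun m hm => hdist n m hm⟩)
  refine ⟨x, fun y => ?_⟩
  -- A counterexample y lies below the limit x, hence below every u n, so it competes at each step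
  -- of the construction; this gives F x ≤ F y.
  by_contra! hy
  have h1 : ∀ n, F (u (n + 1)) ≤ F y + (1 / 2) ^ n := fun n => by
    rw [hu]
    refine hmin n (u n) y ?_
    have := mul_le_mul_of_nonneg_left (dist_triangle (u n) x y) hε.le
    linarith [hdx n]
  have h2 : F x ≤ F y + 0 := le_of_tendsto_of_tendsto' ((tendsto_add_atTop_iff_nat 1).2 hFx)
    (tendsto_const_nhds.add (tendsto_pow_atTop_nhds_zero_of_lt_one (by norm_num) (by norm_num))) h1
  have := mul_nonneg hε.le (dist_nonneg (x := x) (y := y))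
  linarith

/-! ### Geometry of `CAT(0)` spaces -/

/-- Stewart's identity, the Euclidean equality case of the `CAT(0)` inequality. -/
theorem dist_sq_lineMap_eq {E : Type*} [NormedAddCommGroup E] [InnerProductSpace ℝ E]
    (p q r : E) (t : ℝ) : dist p ((1 - t) • q + t • r) ^ 2 =
      (1 - t) * dist p q ^ 2 + t * dist p r ^ 2 - t * (1 - t) * dist q r ^ 2 := by
  have h1 : p - ((1 - t) • q + t • r) = (1 - t) • (p - q) + t • (p - r) := by module
  have h2 : q - r = (p - r) - (p - q) := by abel
  rw [dist_eq_norm, dist_eq_norm, dist_eq_norm, dist_eq_norm, h1, h2, norm_add_sq_real,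
    norm_sub_sq_real (p - r), norm_smul, norm_smul, mul_pow, mul_pow, Real.norm_eq_abs,
    Real.norm_eq_abs, sq_abs, sq_abs, inner_smul_left, inner_smul_right,
    real_inner_comm (p - q) (p - r)]
  simp only [conj_trivial]
  ring

/-- Euclidean triangles with prescribed side lengths. -/
theorem exists_euclidean_triangle {a b c : ℝ} (ha : 0 ≤ a) (hb : 0 ≤ b) (hc : 0 ≤ c)
    (h1 : c ≤ a + b) (h2 : a ≤ b + c) (h3 : b ≤ a + c) :
    ∃ p q r : EuclideanSpace ℝ (Fin 2), dist p q = a ∧ dist p r = b ∧ dist q r = c := by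
  rcases hc.eq_or_lt with rfl | hc
  · obtain rfl : a = b := by linarith
    refine ⟨!₂[a, 0], 0, 0, ?_, ?_, by simp⟩ <;>
      simp [EuclideanSpace.norm_eq, Real.sqrt_sq_eq_abs, abs_of_nonneg ha]
  -- With q = 0 and r = (c, 0), the law of cosines forces this abscissa of p; the triangle
  -- inequalities give |x| ≤ a.
  · obtain ⟨x, hx⟩ : ∃ x, x = (a ^ 2 + c ^ 2 - b ^ 2) / (2 * c) := ⟨_, rfl⟩
    have hx' : 2 * c * x = a ^ 2 + c ^ 2 - b ^ 2 := by rw [hx]; field_simp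
    have hxa : x ^ 2 ≤ a ^ 2 := by
      apply sq_le_sq'
      · have : 0 ≤ 2 * c * (a + x) := by nlinarith
        linarith [nonneg_of_mul_nonneg_right this (by positivity)]
      · have : 0 ≤ 2 * c * (a - x) := by nlinarith
        linarith [nonneg_of_mul_nonneg_right this (by positivity)]
    have hy : √(a ^ 2 - x ^ 2) ^ 2 = a ^ 2 - x ^ 2 := Real.sq_sqrt (by linarith)
    refine ⟨!₂[x, √(a ^ 2 - x ^ 2)], 0, !₂[c, 0], ?_, ?_, ?_⟩
    · simp [EuclideanSpace.norm_eq, hy, Real.sqrt_sq ha]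
    · simp only [EuclideanSpace.dist_eq, Real.dist_eq, Fin.sum_univ_two, sq_abs]
      simp only [Matrix.cons_val_zero, Matrix.cons_val_one, sub_zero, hy]
      rw [show (x - c) ^ 2 + (a ^ 2 - x ^ 2) = b ^ 2 by linear_combination -hx', Real.sqrt_sq hb]
    · simp [EuclideanSpace.dist_eq, Real.dist_eq, Real.sqrt_sq hc.le]

namespace HarmonicMaps

variable {Y : Type*} [MetricSpace Y]

/-- The comparison axiom combined with Stewart's identity. The axiom is used only through this
quadratic form. -/
theorem IsSegment.dist_sq_le [CAT0Space Y] {s : ℝ → Y} {q r : Y} (hs : IsSegment s q r) (p : Y)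
    {t : ℝ} (ht : t ∈ Set.Icc (0 : ℝ) 1) : dist p (s t) ^ 2 ≤
      (1 - t) * dist p q ^ 2 + t * dist p r ^ 2 - t * (1 - t) * dist q r ^ 2 := by
  obtain ⟨p', q', r', h1, h2, h3⟩ := exists_euclidean_triangle (dist_nonneg (x := p) (y := q))
    (dist_nonneg (x := p) (y := r)) (dist_nonneg (x := q) (y := r))
    (dist_triangle_left q r p) (by rw [dist_comm q r]; exact dist_triangle p r q)
    (dist_triangle p q r)
  rw [← h1, ← h2, ← h3, ← dist_sq_lineMap_eq]
  exact pow_le_pow_left₀ dist_nonneg (CAT0Space.comparison p q r s hs p' q' r' h1 h2 h3 t ht) 2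

/-- The point `c` satisfies the inequality of Bruhat and Tits for midpoints of `a` and `b`. -/
def IsMidpoint (a b c : Y) : Prop :=
  ∀ p, dist p c ^ 2 ≤ 1 / 2 * dist p a ^ 2 + 1 / 2 * dist p b ^ 2 - 1 / 4 * dist a b ^ 2

theorem exists_isMidpoint [CAT0Space Y] (a b : Y) : ∃ c, IsMidpoint a b c := by
  obtain ⟨s, hs⟩ := CAT0Space.exists_segment a b
  refine ⟨s (1 / 2), fun p => ?_⟩
  have := hs.dist_sq_le p (t := 1 / 2) ⟨by norm_num, by norm_num⟩
  linarith

theorem IsMidpoint.map {a b c : Y} (h : IsMidpoint a b c) (e : Y ≃ᵢ Y) :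
    IsMidpoint (e a) (e b) (e c) := by
  intro p
  obtain ⟨p, rfl⟩ := e.surjective p
  simpa only [e.dist_eq] using h p

/-- The quadrilateral inequality. -/
theorem dist_sq_add_dist_sq_le [CAT0Space Y] (a b c d : Y) :
    dist a c ^ 2 + dist b d ^ 2 ≤
      dist a b ^ 2 + dist b c ^ 2 + dist c d ^ 2 + dist d a ^ 2 := by
  -- Compare b and d with the midpoint of the diagonal ac, then use (bm + dm)² ≤ 2 bm² + 2 dm².
  obtain ⟨m, hm⟩ := exists_isMidpoint a c
  have h1 := hm b
  have h2 := hm d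
  have h3 := dist_triangle_right b d m
  rw [dist_comm b a] at h1
  rw [dist_comm d c] at h2
  have h4 : dist b d ^ 2 ≤ (dist b m + dist d m) ^ 2 := pow_le_pow_left₀ dist_nonneg h3 2
  nlinarith [sq_nonneg (dist b m - dist d m)]

/-- The midpoint inequality for c', and then for c seen from a' and b', leaves the diagonals ab' and
ba', which the quadrilateral inequality trades for the sides. This convexity of the squared distance
makes the energy convex. -/
theorem IsMidpoint.dist_sq_le [CAT0Space Y] {a b c a' b' c' : Y} (h : IsMidpoint a b c)
    (h' : IsMidpoint a' b' c') :
    dist c c' ^ 2 ≤ 1 / 2 * dist a a' ^ 2 + 1 / 2 * dist b b' ^ 2 := by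
  have h1 := h' c
  have h2 := h a'
  have h3 := h b'
  have h4 := dist_sq_add_dist_sq_le a b b' a'
  rw [dist_comm c a', dist_comm c b'] at h1
  rw [dist_comm a' a, dist_comm a' b] at h2
  rw [dist_comm b' a, dist_comm b' b] at h3
  rw [dist_comm a' a, dist_comm b' a'] at h4
  nlinarith

/-- The first variation of the distance to a point, along a geodesic. -/
theorem dist_sq_le_first_variation [CAT0Space Y] {σ τ : ℝ → Y} {y y' : Y} {u v t : ℝ}
    (hτ : IsSegment τ y y') (hσ0 : σ 0 = y) (hu : 0 < u) (hu1 : u < 1)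
    (hσ : ∀ a ∈ Set.Icc (0 : ℝ) u, ∀ b ∈ Set.Icc (0 : ℝ) u, dist (σ a) (σ b) = v * |a - b|)
    (ht : 0 ≤ t) (htu : t ≤ u) :
    dist (σ t) y' ^ 2 ≤ dist y y' ^ 2 -
      t * (dist y y' ^ 2 + v ^ 2 - (dist (σ u) (τ u) / u) ^ 2) + t ^ 2 * v ^ 2 / u := by
  have hτu : dist (τ u) y' = (1 - u) * dist y y' := by
    have := hτ.dist_eq u ⟨hu.le, hu1.le⟩ 1 ⟨zero_le_one, le_rfl⟩
    rwa [hτ.target, abs_of_neg (by linarith), neg_sub] at this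
  have hτ0 : dist (τ u) y = u * dist y y' := by
    have := hτ.dist_eq u ⟨hu.le, hu1.le⟩ 0 ⟨le_rfl, zero_le_one⟩
    rwa [hτ.source, sub_zero, abs_of_pos hu] at this
  have hσu : dist y (σ u) = u * v := by
    have := hσ 0 ⟨le_rfl, hu.le⟩ u ⟨hu.le, le_rfl⟩
    rwa [hσ0, zero_sub, abs_neg, abs_of_pos hu, mul_comm] at this
  have hseg : IsSegment (fun a => σ (u * a)) y (σ u) := by
    refine ⟨by simp [hσ0], by simp, fun a ha b hb => ?_⟩
    have hmem : ∀ a ∈ Set.Icc (0 : ℝ) 1, u * a ∈ Set.Icc (0 : ℝ) u := fun a ha =>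
      ⟨mul_nonneg hu.le ha.1, mul_le_of_le_one_right hu.le ha.2⟩
    rw [hσ _ (hmem a ha) _ (hmem b hb), hσu, ← mul_sub, abs_mul, abs_of_pos hu]
    ring
  obtain ⟨l, rfl⟩ : ∃ l, t = u * l := ⟨t / u, by field_simp⟩
  have hl : l ∈ Set.Icc (0 : ℝ) 1 := ⟨nonneg_of_mul_nonneg_right ht hu,
    le_of_mul_le_mul_left (by linarith) hu⟩
  have h1 := hseg.dist_sq_le (τ u) hl
  simp only [hσu, hτ0] at h1
  have h2 := dist_triangle (σ (u * l)) (τ u) y'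
  rw [hτu] at h2
  rw [dist_comm (τ u) (σ (u * l)), dist_comm (τ u) (σ u)] at h1
  set A := dist (σ (u * l)) (τ u)
  set D := dist y y'
  set e := dist (σ u) (τ u)
  -- Go through τ u: convexity of the square with weights u and 1 - u, applied to A / u and D.
  have h3 : dist (σ (u * l)) y' ^ 2 ≤ A ^ 2 / u + (1 - u) * D ^ 2 := by
    refine (pow_le_pow_left₀ dist_nonneg h2 2).trans ?_
    rw [div_add' _ _ _ hu.ne', le_div_iff₀ hu]
    nlinarith [mul_nonneg (sub_nonneg.2 hu1.le) (sq_nonneg (A - u * D))]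
  refine h3.trans ?_
  have h4 : A ^ 2 / u ≤ ((1 - l) * (u * D) ^ 2 + l * e ^ 2 - l * (1 - l) * (u * v) ^ 2) / u := by
    gcongr
  refine (add_le_add_left h4 _).trans (le_of_eq ?_)
  field_simp
  ring

end HarmonicMaps

/-- A continuous quasi-convex function which is almost minimized on a bounded set has a minimum:
boundedness and convexity are expressed by means of a uniformly convex function `Q`. -/
theorem exists_forall_le_of_uniformConvex {M : Type*} [MetricSpace M] [CompleteSpace M]
    {G Q : M → ℝ} (hG : Continuous G) (hQ : ∀ a, 0 ≤ Q a)
    (hmid : ∀ a b, ∃ c, G c ≤ max (G a) (G b) ∧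
      Q c ≤ 1 / 2 * Q a + 1 / 2 * Q b - 1 / 4 * dist a b ^ 2)
    {R : ℝ} (hR : ∀ δ > 0, ∃ a, Q a ≤ R ∧ ∀ b, G a ≤ G b + δ) :
    ∃ a, ∀ b, G a ≤ G b := by
  let ε : ℕ → ℝ := fun n => 1 / ((n : ℝ) + 1)
  have hε : ∀ n, 0 < ε n := fun n => by positivity
  have hε0 : Tendsto ε atTop (𝓝 0) := tendsto_one_div_add_atTop_nhds_zero_nat
  have hanti : Antitone ε := fun n m h => Nat.one_div_le_one_div h
  let C : ℕ → Set M := fun n => {a | ∀ b, G a ≤ G b + ε n}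
  have hC : ∀ {n m}, n ≤ m → C m ⊆ C n := fun h a ha b => (ha b).trans (by gcongr; exact hanti h)
  let d : ℕ → ℝ := fun n => sInf (Q '' C n)
  have hne : ∀ n, (Q '' C n).Nonempty := fun n => by
    obtain ⟨a, -, ha⟩ := hR (ε n) (hε n)
    exact ⟨_, a, ha, rfl⟩
  have hbdd : ∀ n, BddBelow (Q '' C n) := fun n => ⟨0, by rintro _ ⟨w, -, rfl⟩; exact hQ w⟩
  have hd : ∀ {n a}, a ∈ C n → d n ≤ Q a := fun {n a} ha => csInf_le (hbdd n) ⟨a, ha, rfl⟩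
  have hmono : Monotone d := fun n m h =>
    csInf_le_csInf (hbdd n) (hne m) (Set.image_mono (hC h))
  have hdR : BddAbove (Set.range d) := ⟨R, by
    rintro _ ⟨n, rfl⟩
    obtain ⟨a, haR, ha⟩ := hR (ε n) (hε n)
    exact (hd (n := n) ha).trans haR⟩
  have hlim := tendsto_atTop_ciSup hmono hdR
  set L := ⨆ n, d n
  have hex : ∀ n, ∃ a ∈ C n, Q a ≤ d n + ε n := fun n => by
    obtain ⟨_, ⟨a, ha, rfl⟩, hlt⟩ :=
      exists_lt_of_csInf_lt (hne n) (lt_add_of_pos_right (d n) (hε n))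
    exact ⟨a, ha, hlt.le⟩
  choose u huC huQ using hex
  -- The midpoint of u n and u m is still in C n, so its Q is at least d n. As d increases to a
  -- finite limit L, uniform convexity makes u a Cauchy sequence.
  have hdist : ∀ n m, n ≤ m → dist (u n) (u m) ^ 2 ≤ 2 * (L - d n) + 4 * ε n := by
    intro n m h
    obtain ⟨c, hc1, hc2⟩ := hmid (u n) (u m)
    have hcC : c ∈ C n := fun b => hc1.trans (max_le (huC n b) (hC h (huC m) b))
    have h1 := hd hcC
    have h2 := huQ n
    have h3 := huQ m
    have h4 : d m ≤ L := hmono.ge_of_tendsto hlim m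
    have h5 := hanti h
    linarith
  have hcau : CauchySeq u := by
    refine cauchySeq_of_le_tendsto_0' (fun n => √(2 * (L - d n) + 4 * ε n))
      (fun n m h => Real.le_sqrt_of_sq_le (hdist n m h)) ?_
    have : Tendsto (fun n => 2 * (L - d n) + 4 * ε n) atTop (𝓝 (2 * (L - L) + 4 * 0)) :=
      ((hlim.const_sub L).const_mul 2).add (hε0.const_mul 4)
    simpa using this.sqrt
  obtain ⟨a, ha⟩ := cauchySeq_tendsto_of_complete hcau
  refine ⟨a, fun b => ?_⟩
  have h1 : Tendsto (fun n => G b + ε n) atTop (𝓝 (G b + 0)) := hε0.const_add _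
  rw [add_zero] at h1
  exact le_of_tendsto_of_tendsto' ((hG.tendsto a).comp ha) h1 fun n => huC n b

namespace HarmonicMaps

namespace UniversalCovering

variable {W : Type*} [Fintype W] [DecidableEq W] {Z : AbstractSimplicialComplex W}
  {Γ : Type*} [Group Γ] {V : Type*} [DecidableEq V] [MulAction Γ V]
  {Y : Type*} [MetricSpace Y]

/-! ### The square root of the energy as a function on `W → Y` -/

/-- The square root of the energy of the equivariant map with given values on the lifts. -/
noncomputable def rootEnergy (X : UniversalCovering Z Γ V) (m : Weight Z) (ρ : Γ →* (Y ≃ᵢ Y))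
    (h : W → Y) : ℝ :=
  √(X.energy m (X.extend ρ h))

theorem rootEnergy_nonneg (X : UniversalCovering Z Γ V) (m : Weight Z) (ρ : Γ →* (Y ≃ᵢ Y))
    (h : W → Y) : 0 ≤ X.rootEnergy m ρ h :=
  Real.sqrt_nonneg _

theorem rootEnergy_sq (X : UniversalCovering Z Γ V) (m : Weight Z) (ρ : Γ →* (Y ≃ᵢ Y))
    (h : W → Y) : X.rootEnergy m ρ h ^ 2 = X.energy m (X.extend ρ h) :=
  Real.sq_sqrt (X.energy_nonneg m _)

theorem continuous_rootEnergy (X : UniversalCovering Z Γ V) (m : Weight Z)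
    (ρ : Γ →* (Y ≃ᵢ Y)) : Continuous (X.rootEnergy m ρ) := by
  refine Real.continuous_sqrt.comp (continuous_const.mul ?_)
  refine continuous_finsetSum _ fun z _ => continuous_finsetSum _ fun c _ => ?_
  exact continuous_const.mul
    (((X.continuous_extend ρ _).dist (X.continuous_extend ρ _)).pow 2)

theorem exists_dist_le_rootEnergy (X : UniversalCovering Z Γ V) (m : Weight Z)
    (ρ : Γ →* (Y ≃ᵢ Y)) (z₀ : W) :
    ∃ C : ℝ, 0 ≤ C ∧ ∀ h z, dist (h z) (h z₀) ≤ C * X.rootEnergy m ρ h := by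
  have := fun z => X.exists_dist_le_sqrt_energy (Y := Y) m (X.lift z) (X.lift z₀)
  choose C hC0 hC using this
  refine ⟨∑ z, C z, Finset.sum_nonneg fun z _ => hC0 z, fun h z => ?_⟩
  have h1 := hC z ρ _ (X.isEquivariant_extend ρ h)
  rw [X.extend_lift, X.extend_lift] at h1
  refine h1.trans (mul_le_mul_of_nonneg_right ?_ (Real.sqrt_nonneg _))
  exact Finset.single_le_sum (fun z _ => hC0 z) (Finset.mem_univ z)

/-- Isometries preserve midpoints, so the extension of c is a midpoint at every vertex, and each
term of the energy is convex. -/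
theorem energy_extend_midpoint_le [CAT0Space Y] (X : UniversalCovering Z Γ V) (m : Weight Z)
    (ρ : Γ →* (Y ≃ᵢ Y)) {a b c : W → Y} (h : ∀ z, IsMidpoint (a z) (b z) (c z)) :
    X.energy m (X.extend ρ c) ≤
      1 / 2 * X.energy m (X.extend ρ a) + 1 / 2 * X.energy m (X.extend ρ b) := by
  have hv : ∀ v, IsMidpoint (X.extend ρ a v) (X.extend ρ b v) (X.extend ρ c v) := fun v =>
    (h _).map _
  simp only [energy]
  rw [mul_left_comm, mul_left_comm (1 / 2), ← mul_add]
  refine mul_le_mul_of_nonneg_left ?_ (by norm_num)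
  simp only [Finset.mul_sum, ← Finset.sum_add_distrib]
  refine Finset.sum_le_sum fun z _ => Finset.sum_le_sum fun v hv' => ?_
  have h1 := mul_le_mul_of_nonneg_left ((hv (X.lift z)).dist_sq_le (hv v))
    (X.edgeWeight_pos m hv').le
  linarith

/-- If almost critical points stay in a bounded set, then the energy has a minimum. -/
theorem exists_minimizer [CAT0Space Y] [CompleteSpace Y] (X : UniversalCovering Z Γ V)
    (m : Weight Z) (ρ : Γ →* (Y ≃ᵢ Y)) (y₀ : Y) (z₀ : W) {η₀ R : ℝ} (hη₀ : 0 < η₀)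
    (hR : ∀ h, (∀ g, X.rootEnergy m ρ h ≤ X.rootEnergy m ρ g + η₀ * dist h g) →
      dist y₀ (h z₀) ≤ R) :
    ∃ h, ∀ g, X.rootEnergy m ρ h ≤ X.rootEnergy m ρ g := by
  obtain ⟨C, hC0, hC⟩ := X.exists_dist_le_rootEnergy m ρ z₀
  set F := X.rootEnergy m ρ
  have hF0 : ∀ h, 0 ≤ F h := X.rootEnergy_nonneg m ρ
  have : Nonempty Y := ⟨y₀⟩
  let g₀ : W → Y := fun _ => y₀
  have hR' : 0 ≤ max R 0 := le_max_right _ _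
  set R' := max R 0
  -- For η-critical h, compare with the constant `g₀`: since d(h, g₀) ≤ C F(h) + R', the condition η
  -- C ≤ 1/2 absorbs half of F(h) and gives F(h) ≤ 2 (F(g₀) + R').
  set R₀ := C * (2 * (F g₀ + R')) + R'
  have hR₀ : 0 ≤ R₀ := add_nonneg (mul_nonneg hC0
    (mul_nonneg zero_le_two (add_nonneg (hF0 _) hR'))) hR'
  have hEk : ∀ η, 0 < η → η ≤ η₀ → η ≤ 1 → η * C ≤ 1 / 2 →
      ∃ h, dist h g₀ ≤ R₀ ∧ ∀ g, F h ≤ F g + η * dist h g := by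
    intro η hη hη0 hη1 hηC
    obtain ⟨h, hh⟩ := exists_forall_le_add_mul_dist (X.continuous_rootEnergy m ρ) hF0 hη
    have h1 : dist y₀ (h z₀) ≤ R' := (hR h fun g => (hh g).trans (by gcongr)).trans
      (le_max_left _ _)
    have h2 : dist h g₀ ≤ C * F h + R' := by
      refine (dist_pi_le_iff (add_nonneg (mul_nonneg hC0 (hF0 h)) hR')).2 fun z => ?_
      have := dist_triangle (h z) (h z₀) y₀
      rw [dist_comm (h z₀)] at this
      exact this.trans (add_le_add (hC h z) h1)
    have h3 : F h ≤ 2 * (F g₀ + R') := by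
      have e1 : F h ≤ F g₀ + η * dist h g₀ := hh g₀
      have e2 : η * dist h g₀ ≤ η * (C * F h + R') := by gcongr
      have e3 : η * C * F h ≤ 1 / 2 * F h := by gcongr; exact hF0 h
      have e4 : η * R' ≤ 1 * R' := by gcongr
      linarith
    exact ⟨h, h2.trans (by simp only [R₀]; gcongr), hh⟩
  have hadm : ∀ t > 0, ∃ η, 0 < η ∧ η ≤ η₀ ∧ η ≤ 1 ∧ η * C ≤ 1 / 2 ∧ η ≤ t := by
    intro t ht
    refine ⟨min (min η₀ t) (1 / (2 * (C + 1))), by positivity,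
      (min_le_left _ _).trans (min_le_left _ _), (min_le_right _ _).trans ?_, ?_,
      (min_le_left _ _).trans (min_le_right _ _)⟩
    · rw [div_le_one (by positivity)]; linarith
    · refine (mul_le_mul_of_nonneg_right (min_le_right _ _) hC0).trans ?_
      rw [div_mul_eq_mul_div, div_le_div_iff₀ (by positivity) (by norm_num)]
      linarith
  let Q : (W → Y) → ℝ := fun h => ∑ z, dist y₀ (h z) ^ 2
  refine exists_forall_le_of_uniformConvex (Q := Q) (R := ∑ _z : W, R₀ ^ 2)
    (X.continuous_rootEnergy m ρ) (fun a => Finset.sum_nonneg fun z _ => sq_nonneg _) ?_ ?_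
  · intro a b
    choose c hc using fun z => exists_isMidpoint (a z) (b z)
    refine ⟨c, ?_, ?_⟩
    · refine Real.sqrt_le_iff.2 ⟨(hF0 a).trans (le_max_left _ _), ?_⟩
      refine (X.energy_extend_midpoint_le m ρ hc).trans ?_
      rw [← X.rootEnergy_sq, ← X.rootEnergy_sq]
      have e1 : X.rootEnergy m ρ a ^ 2 ≤ max (F a) (F b) ^ 2 :=
        pow_le_pow_left₀ (hF0 a) (le_max_left _ _) 2
      have e2 : X.rootEnergy m ρ b ^ 2 ≤ max (F a) (F b) ^ 2 :=
        pow_le_pow_left₀ (hF0 b) (le_max_right _ _) 2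
      linarith
    · have e1 : Q c ≤ 1 / 2 * Q a + 1 / 2 * Q b - 1 / 4 * ∑ z, dist (a z) (b z) ^ 2 := by
        simp only [Q, Finset.mul_sum, ← Finset.sum_add_distrib, ← Finset.sum_sub_distrib]
        exact Finset.sum_le_sum fun z _ => hc z y₀
      have e2 : dist a b ^ 2 ≤ ∑ z, dist (a z) (b z) ^ 2 := by
        refine (Real.le_sqrt dist_nonneg (Finset.sum_nonneg fun z _ => sq_nonneg _)).1 ?_
        refine (dist_pi_le_iff (Real.sqrt_nonneg _)).2 fun z => Real.le_sqrt_of_sq_le ?_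
        exact Finset.single_le_sum (f := fun z => dist (a z) (b z) ^ 2)
          (fun z _ => sq_nonneg _) (Finset.mem_univ z)
      linarith
  -- Take g minimizing F up to δ/2. An η-critical h stays within R₀ of `g₀`, so for η small enough η
  -- d(h,g) ≤ δ/2 and h minimizes F up to δ.
  · intro δ hδ
    have hbdd : BddBelow (Set.range F) := ⟨0, by rintro _ ⟨h, rfl⟩; exact hF0 h⟩
    obtain ⟨g, hg⟩ := exists_lt_of_ciInf_lt
      (lt_add_of_pos_right (iInf F) (half_pos hδ))
    have hpos : 0 < R₀ + dist g₀ g + 1 := by positivity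
    obtain ⟨η, hη, hη0, hη1, hηC, hηt⟩ := hadm (δ / 2 / (R₀ + dist g₀ g + 1)) (by positivity)
    obtain ⟨h, hh, hE⟩ := hEk η hη hη0 hη1 hηC
    refine ⟨h, Finset.sum_le_sum fun z _ => ?_, fun b => ?_⟩
    · rw [dist_comm]
      exact pow_le_pow_left₀ dist_nonneg ((dist_le_pi_dist h g₀ z).trans hh) 2
    · have e1 := hE g
      have e2 : η * dist h g ≤ η * (R₀ + dist g₀ g + 1) := by
        gcongr
        have := dist_triangle h g₀ g
        linarith
      have e3 := (le_div_iff₀ hpos).1 hηt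
      have e4 := ciInf_le hbdd b
      change F h ≤ F b + δ
      linarith

end UniversalCovering

/-! ### The action induced on an ultralimit -/

section InducedAction

variable {Γ : Type*} [Group Γ] {Y : Type*} [MetricSpace Y] (ρ : Γ →* (Y ≃ᵢ Y))
  {ω : Ultrafilter ℕ} {r : ℕ → Set.Ioi (0 : ℝ)} {y : ℕ → Y}

theorem BoundedSeq.ext_point {w w' : BoundedSeq ω (fun j => Rescaled (r j) Y) (fun j => ⟨y j⟩)}
    (h : ∀ j, (w.seq j).point = (w'.seq j).point) : w = w' := by
  rcases w with ⟨w, _⟩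
  rcases w' with ⟨w', _⟩
  obtain rfl : w = w' := funext fun j => congrArg Rescaled.mk (h j)
  rfl

/-- The action of a group element on bounded sequences, when base points are moved by a bounded
amount. -/
noncomputable def BoundedSeq.smulSeq (hb : ∀ γ : Γ, ∃ C : ℝ, ∀ j, r j * dist (ρ γ (y j)) (y j) ≤ C) (γ : Γ)
    (w : BoundedSeq ω (fun j => Rescaled (r j) Y) (fun j => ⟨y j⟩)) :
    BoundedSeq ω (fun j => Rescaled (r j) Y) (fun j => ⟨y j⟩) where
  seq j := ⟨ρ γ (w.seq j).point⟩
  bounded := by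
    obtain ⟨C, hC⟩ := hb γ
    obtain ⟨D, hD⟩ := w.bounded
    refine ⟨D + C, fun j => ?_⟩
    have h1 : r j * dist (w.seq j).point (y j) ≤ D := hD j
    have h2 := mul_le_mul_of_nonneg_left
      (dist_triangle (ρ γ (w.seq j).point) (ρ γ (y j)) (y j)) (le_of_lt (r j).2)
    rw [(ρ γ).dist_eq, mul_add] at h2
    exact h2.trans (add_le_add h1 (hC j))

variable (hb : ∀ γ : Γ, ∃ C : ℝ, ∀ j, r j * dist (ρ γ (y j)) (y j) ≤ C)

theorem BoundedSeq.dist_smulSeq (γ : Γ)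
    (w w' : BoundedSeq ω (fun j => Rescaled (r j) Y) (fun j => ⟨y j⟩)) :
    dist (w.smulSeq ρ hb γ) (w'.smulSeq ρ hb γ) = dist w w' := by
  change limUnder _ _ = limUnder _ _
  congr 1
  funext j
  exact congrArg (fun t => (r j : ℝ) * t) ((ρ γ).dist_eq _ _)

/-- The map induced by a group element on the ultralimit. -/
noncomputable def inducedMap (γ : Γ) : RescaledLimit ω r Y y → RescaledLimit ω r Y y :=
  SeparationQuotient.lift (fun w => SeparationQuotient.mk (w.smulSeq ρ hb γ)) fun w w' h => by
    rw [SeparationQuotient.mk_eq_mk, Metric.inseparable_iff, BoundedSeq.dist_smulSeq,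
      ← Metric.inseparable_iff]
    exact h

theorem inducedMap_mk (γ : Γ)
    (w : BoundedSeq ω (fun j => Rescaled (r j) Y) (fun j => ⟨y j⟩)) :
    inducedMap ρ hb γ (SeparationQuotient.mk w) = SeparationQuotient.mk (w.smulSeq ρ hb γ) :=
  rfl

theorem inducedMap_one (a : RescaledLimit ω r Y y) : inducedMap ρ hb 1 a = a := by
  obtain ⟨w, rfl⟩ := SeparationQuotient.surjective_mk a
  rw [inducedMap_mk]
  congr 1
  exact BoundedSeq.ext_point fun j => by simp [BoundedSeq.smulSeq]

theorem inducedMap_mul (γ γ' : Γ) (a : RescaledLimit ω r Y y) :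
    inducedMap ρ hb (γ * γ') a = inducedMap ρ hb γ (inducedMap ρ hb γ' a) := by
  obtain ⟨w, rfl⟩ := SeparationQuotient.surjective_mk a
  rw [inducedMap_mk, inducedMap_mk, inducedMap_mk]
  congr 1
  exact BoundedSeq.ext_point fun j => by simp [BoundedSeq.smulSeq]

theorem isometry_inducedMap (γ : Γ) :
    Isometry (inducedMap ρ hb γ : RescaledLimit ω r Y y → RescaledLimit ω r Y y) := by
  refine Isometry.of_dist_eq fun a b => ?_
  obtain ⟨w, rfl⟩ := SeparationQuotient.surjective_mk a
  obtain ⟨w', rfl⟩ := SeparationQuotient.surjective_mk b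
  rw [inducedMap_mk, inducedMap_mk, SeparationQuotient.dist_mk, SeparationQuotient.dist_mk,
    BoundedSeq.dist_smulSeq]

/-- The action induced on the ultralimit. -/
noncomputable def inducedAction : Γ →* (RescaledLimit ω r Y y ≃ᵢ RescaledLimit ω r Y y) where
  toFun γ := IsometryEquiv.mk' (inducedMap ρ hb γ) (inducedMap ρ hb γ⁻¹)
    (fun a => by rw [← inducedMap_mul, mul_inv_cancel, inducedMap_one])
    (isometry_inducedMap ρ hb γ)
  map_one' := by
    ext a
    exact inducedMap_one ρ hb a
  map_mul' γ γ' := by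
    ext a
    exact inducedMap_mul ρ hb γ γ' a

theorem inducedAction_mk (γ : Γ)
    (w : BoundedSeq ω (fun j => Rescaled (r j) Y) (fun j => ⟨y j⟩)) :
    inducedAction ρ hb γ (SeparationQuotient.mk w) =
      SeparationQuotient.mk (w.smulSeq ρ hb γ) :=
  rfl

theorem isInducedAction_inducedAction :
    IsInducedAction ρ (inducedAction (ω := ω) ρ hb) := fun γ w =>
  ⟨w.smulSeq ρ hb γ, fun _ => rfl, rfl⟩

end InducedAction

/-! ### Harmonic maps into ultralimits -/

namespace UniversalCovering

variable {W : Type*} [Fintype W] [DecidableEq W] {Z : AbstractSimplicialComplex W}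
  {Γ : Type*} [Group Γ] {V : Type*} [DecidableEq V] [MulAction Γ V]
  {Y : Type*} [MetricSpace Y]

/-- Energies pass to ultralimits. -/
theorem tendsto_energy (X : UniversalCovering Z Γ V) (m : Weight Z) {ω : Ultrafilter ℕ}
    {r : ℕ → Set.Ioi (0 : ℝ)} {y : ℕ → Y}
    (w : V → BoundedSeq ω (fun j => Rescaled (r j) Y) (fun j => ⟨y j⟩)) :
    Tendsto (fun j => (r j : ℝ) ^ 2 * X.energy m (fun v => ((w v).seq j).point)) ω
      (𝓝 (X.energy m (fun v => (SeparationQuotient.mk (w v) : RescaledLimit ω r Y y)))) := by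
  have h : ∀ j, (r j : ℝ) ^ 2 * X.energy m (fun v => ((w v).seq j).point) =
      1 / 2 * ∑ z : W, ∑ c ∈ X.link (X.lift z), X.edgeWeight m (X.lift z) c *
        dist ((w (X.lift z)).seq j) ((w c).seq j) ^ 2 := by
    intro j
    rw [energy, mul_left_comm, Finset.mul_sum]
    congr 1
    refine Finset.sum_congr rfl fun z _ => ?_
    rw [Finset.mul_sum]
    refine Finset.sum_congr rfl fun c _ => ?_
    change _ = _ * ((r j : ℝ) * dist _ _) ^ 2
    ring
  rw [tendsto_congr h, energy]
  refine Tendsto.const_mul _ ?_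
  refine tendsto_finsetSum _ fun z _ => ?_
  refine tendsto_finsetSum _ fun c _ => ?_
  rw [SeparationQuotient.dist_mk]
  exact ((BoundedSeq.tendsto_ultraDist _ _).pow 2).const_mul _

/-- A sequence of almost critical maps yields a nonconstant harmonic map with values in the
ultralimit of `Y`, rescaled so that the energies are normalized. -/
theorem exists_isHarmonic_rescaledLimit (X : UniversalCovering Z Γ V) (m : Weight Z)
    (ρ : Γ →* (Y ≃ᵢ Y)) {ω : Ultrafilter ℕ} (hω : (ω : Filter ℕ) ≤ atTop) {h : ℕ → W → Y}
    {η : ℕ → ℝ} (hη0 : ∀ j, 0 ≤ η j) (hη : Tendsto η atTop (𝓝 0))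
    (hpos : ∀ j, 0 < X.rootEnergy m ρ (h j))
    (hh : ∀ j g, X.rootEnergy m ρ (h j) ≤ X.rootEnergy m ρ g + η j * dist (h j) g) (z₀ : W) :
    ∃ (r : ℕ → Set.Ioi (0 : ℝ)) (ρω : Γ →* (RescaledLimit ω r Y (fun j => h j z₀) ≃ᵢ
        RescaledLimit ω r Y (fun j => h j z₀))),
      IsInducedAction ρ ρω ∧ ∃ f : V → RescaledLimit ω r Y (fun j => h j z₀),
        X.IsHarmonic m ρω f ∧ ∃ x x' : V, f x ≠ f x' := by
  -- This scale makes every rescaled energy equal to 1, so distances between values on fixed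
  -- vertices stay bounded.
  let r : ℕ → Set.Ioi (0 : ℝ) := fun j => ⟨(X.rootEnergy m ρ (h j))⁻¹, inv_pos.2 (hpos j)⟩
  let y : ℕ → Y := fun j => h j z₀
  have hr : ∀ j, (r j : ℝ) * X.rootEnergy m ρ (h j) = 1 := fun j => inv_mul_cancel₀ (hpos j).ne'
  have hbv : ∀ v, ∃ C, ∀ j, (r j : ℝ) * dist (X.extend ρ (h j) v) (y j) ≤ C := by
    intro v
    obtain ⟨C, hC0, hC⟩ := X.exists_dist_le_sqrt_energy (Y := Y) m v (X.lift z₀)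
    refine ⟨C, fun j => ?_⟩
    have h1 := hC ρ _ (X.isEquivariant_extend ρ (h j))
    rw [X.extend_lift] at h1
    refine (mul_le_mul_of_nonneg_left h1 (le_of_lt (r j).2)).trans (le_of_eq ?_)
    rw [mul_left_comm]
    change C * ((r j : ℝ) * X.rootEnergy m ρ (h j)) = C
    rw [hr, mul_one]
  have hb : ∀ γ : Γ, ∃ C : ℝ, ∀ j, r j * dist (ρ γ (y j)) (y j) ≤ C := by
    intro γ
    obtain ⟨C, hC⟩ := hbv (γ • X.lift z₀)
    refine ⟨C, fun j => ?_⟩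
    have := hC j
    rwa [X.isEquivariant_extend ρ (h j), X.extend_lift] at this
  let w : V → BoundedSeq ω (fun j => Rescaled (r j) Y) (fun j => ⟨y j⟩) := fun v =>
    ⟨fun j => ⟨X.extend ρ (h j) v⟩, hbv v⟩
  let f : V → RescaledLimit ω r Y y := fun v => SeparationQuotient.mk (w v)
  have hf : X.IsEquivariant (inducedAction ρ hb) f := by
    intro γ v
    simp only [f]
    rw [inducedAction_mk]
    congr 1
    exact BoundedSeq.ext_point fun j => X.isEquivariant_extend ρ (h j) γ v
  have hEf : X.energy m f = 1 := by
    refine tendsto_nhds_unique (X.tendsto_energy m w) (tendsto_const_nhds.congr fun j => ?_)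
    change 1 = (r j : ℝ) ^ 2 * X.energy m (X.extend ρ (h j))
    rw [← X.rootEnergy_sq, ← mul_pow, hr, one_pow]
  -- The radius 1 is arbitrary: f minimizes the energy among all equivariant maps.
  refine ⟨r, inducedAction ρ hb, isInducedAction_inducedAction ρ hb, f,
    ⟨hf, 1, one_pos, fun g hg _ => ?_⟩, ?_⟩
  · choose s hs using fun z => SeparationQuotient.surjective_mk (g (X.lift z))
    let k : ℕ → W → Y := fun j z => ((s z).seq j).point
    let w' : V → BoundedSeq ω (fun j => Rescaled (r j) Y) (fun j => ⟨y j⟩) := fun v =>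
      (s (X.proj v)).smulSeq ρ hb (X.deck v)
    have hgw : g = fun v => SeparationQuotient.mk (w' v) := by
      funext v
      simp only [w']
      rw [← inducedAction_mk, hs, ← hg, X.deck_smul_lift]
    have hlim : Tendsto (fun j => (r j : ℝ) * X.rootEnergy m ρ (k j)) ω
        (𝓝 √(X.energy m g)) := by
      have := (X.tendsto_energy m w').sqrt
      rw [← hgw] at this
      refine this.congr fun j => ?_
      rw [Real.sqrt_mul (sq_nonneg _), Real.sqrt_sq (le_of_lt (r j).2)]
      rfl
    obtain ⟨B, hB0, hB⟩ : ∃ B : ℝ, 0 ≤ B ∧ ∀ j, (r j : ℝ) * dist (h j) (k j) ≤ B := by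
      choose C hC using fun z => hbv (X.lift z)
      choose D hD using fun z => (s z).bounded
      have hle : ∀ z j, (r j : ℝ) * dist (h j z) (k j z) ≤ |C z + D z| := by
        intro z j
        have h1 := hC z j
        have h2 : (r j : ℝ) * dist (k j z) (y j) ≤ D z := hD z j
        rw [X.extend_lift] at h1
        have h3 := mul_le_mul_of_nonneg_left (dist_triangle_right (h j z) (k j z) (y j))
          (le_of_lt (r j).2)
        exact le_trans (by linarith) (le_abs_self _)
      refine ⟨∑ z, |C z + D z|, Finset.sum_nonneg fun z _ => abs_nonneg _, fun j => ?_⟩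
      have hrj : 0 < (r j : ℝ) := (r j).2
      rw [mul_comm, ← le_div_iff₀ hrj]
      refine (dist_pi_le_iff (div_nonneg (Finset.sum_nonneg fun z _ => abs_nonneg _)
        hrj.le)).2 fun z => ?_
      rw [le_div_iff₀ hrj, mul_comm]
      exact (hle z j).trans (Finset.single_le_sum (f := fun z => |C z + D z|)
        (fun z _ => abs_nonneg _) (Finset.mem_univ z))
    -- The critical inequality multiplied by r j. A competitor stays at bounded rescaled distance B,
    -- so the error η j * B disappears in the limit.
    have hle : ∀ j, 1 ≤ (r j : ℝ) * X.rootEnergy m ρ (k j) + η j * B := by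
      intro j
      have h1 := mul_le_mul_of_nonneg_left (hh j (k j)) (le_of_lt (r j).2)
      have h2 := mul_le_mul_of_nonneg_left (hB j) (hη0 j)
      rw [hr] at h1
      linarith
    have h1 := ge_of_tendsto' (hlim.add ((hη.mono_left hω).mul_const B)) hle
    rw [zero_mul, add_zero] at h1
    rw [hEf]
    exact Real.one_le_sqrt.1 h1
  · by_contra! hc
    rw [X.energy_eq_zero_of_const m hc] at hEf
    exact zero_ne_one hEf

end UniversalCovering

/-! ### First variation in the tangent cone -/

namespace GeodesicGerm

variable {Y : Type*} [MetricSpace Y] {y : Y}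

theorem dist_def (s s' : GeodesicGerm y) :
    dist s s' = limsup (fun t : ℝ => dist (s.toFun t) (s'.toFun t) / t) (𝓝[>] 0) :=
  rfl

/-- The speed of a germ is its distance to the apex. -/
theorem dist_apex_eq (s : GeodesicGerm y) {v ε : ℝ} (hε : 0 < ε)
    (h : ∀ a ∈ Set.Icc (0 : ℝ) ε, ∀ b ∈ Set.Icc (0 : ℝ) ε,
      dist (s.toFun a) (s.toFun b) = v * |a - b|) :
    dist (s : TangentCone y) (TangentCone.apex y) = v := by
  rw [TangentCone.apex, UniformSpace.Completion.dist_eq, dist_def]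
  rw [limsup_congr (v := fun _ => v), limsup_const]
  filter_upwards [Ioo_mem_nhdsGT hε] with t ht
  have := h t ⟨ht.1.le, ht.2.le⟩ 0 ⟨le_rfl, hε.le⟩
  rw [s.map_zero, sub_zero, abs_of_pos ht.1] at this
  rw [this, mul_div_cancel_right₀ _ ht.1.ne']

theorem eventually_dist_le (s : GeodesicGerm y) : ∀ᶠ t in 𝓝[>] (0 : ℝ),
    dist y (s.toFun t) ≤ dist (s : TangentCone y) (TangentCone.apex y) * t := by
  obtain ⟨v, ε, -, hε, h⟩ := s.exists_speed
  rw [s.dist_apex_eq hε h]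
  filter_upwards [Ioo_mem_nhdsGT hε] with t ht
  have := h 0 ⟨le_rfl, hε.le⟩ t ⟨ht.1.le, ht.2.le⟩
  rw [s.map_zero, zero_sub, abs_neg, abs_of_pos ht.1] at this
  exact this.le

theorem dist_proj_apex [CAT0Space Y] (y' : Y) :
    dist (TangentCone.proj y y') (TangentCone.apex y) = dist y y' :=
  dist_apex_eq _ one_pos fun a ha b hb =>
    ((CAT0Space.exists_segment y y').choose_spec.dist_eq a ha b hb).trans (mul_comm _ _)

theorem exists_eventually_dist_sq_le [CAT0Space Y] (s : GeodesicGerm y) (y' : Y) {δ : ℝ}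
    (hδ : dist (TangentCone.proj y y') s < δ) :
    ∃ K : ℝ, ∀ᶠ t in 𝓝[>] (0 : ℝ), dist (s.toFun t) y' ^ 2 ≤ dist y y' ^ 2 -
      t * (dist (TangentCone.proj y y') (TangentCone.apex y) ^ 2 +
        dist (s : TangentCone y) (TangentCone.apex y) ^ 2 - δ ^ 2) + t ^ 2 * K := by
  obtain ⟨v, ε, -, hε, h⟩ := s.exists_speed
  rw [s.dist_apex_eq hε h, dist_proj_apex]
  rw [dist_comm, TangentCone.proj, UniformSpace.Completion.dist_eq, dist_def] at hδ
  have hlt := eventually_lt_of_limsup_lt hδ (isBoundedUnder_quotient s (segmentGerm y y'))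
  obtain ⟨u, hu, hu2⟩ := (hlt.and (Ioo_mem_nhdsGT (lt_min hε one_pos))).exists
  have hu0 : 0 < u := hu2.1
  refine ⟨v ^ 2 / u, ?_⟩
  filter_upwards [Ioo_mem_nhdsGT hu0] with t ht
  have huε : u ≤ ε := hu2.2.le.trans (min_le_left _ _)
  have h1 := dist_sq_le_first_variation (CAT0Space.exists_segment y y').choose_spec s.map_zero
    hu0 (hu2.2.trans_le (min_le_right _ _))
    (fun a ha b hb => h a ⟨ha.1, ha.2.trans huε⟩ b ⟨hb.1, hb.2.trans huε⟩) ht.1.le ht.2.le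
  have h2 : (dist (s.toFun u) ((CAT0Space.exists_segment y y').choose u) / u) ^ 2 ≤ δ ^ 2 :=
    pow_le_pow_left₀ (div_nonneg dist_nonneg hu0.le) hu.le 2
  have h3 := mul_le_mul_of_nonneg_left h2 ht.1.le
  rw [mul_div_assoc] at h1
  linarith

end GeodesicGerm

namespace UniversalCovering

variable {W : Type*} [Fintype W] [DecidableEq W] {Z : AbstractSimplicialComplex W}
  {Γ : Type*} [Group Γ] {V : Type*} [DecidableEq V] [MulAction Γ V]
  {Y : Type*} [MetricSpace Y]

/-- The variation of the energy when the value at one vertex of `Z` is modified. -/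
theorem energy_extend_update (X : UniversalCovering Z Γ V) (m : Weight Z) (ρ : Γ →* (Y ≃ᵢ Y))
    (h : W → Y) (z₀ : W) (p : Y) :
    X.energy m (X.extend ρ (Function.update h z₀ p)) = X.energy m (X.extend ρ h) +
      ∑ c ∈ X.link (X.lift z₀), X.edgeWeight m (X.lift z₀) c *
        (dist p (X.extend ρ h c) ^ 2 - dist (X.extend ρ h (X.lift z₀)) (X.extend ρ h c) ^ 2) := by
  have hgf : ∀ v, X.proj v ≠ z₀ →
      X.extend ρ (Function.update h z₀ p) v = X.extend ρ h v := fun v hv => by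
    simp [extend, Function.update_of_ne hv]
  have hg0 : X.extend ρ (Function.update h z₀ p) (X.lift z₀) = p := by
    rw [X.extend_lift, Function.update_self]
  have hgeq := X.isEquivariant_extend ρ (Function.update h z₀ p)
  have hfeq := X.isEquivariant_extend ρ h
  set g := X.extend ρ (Function.update h z₀ p)
  set f := X.extend ρ h
  let φ : V → V → ℝ := fun x x' =>
    X.edgeWeight m x x' * (dist (g x) (g x') ^ 2 - dist (f x) (f x') ^ 2)
  have hφ : ∀ x x', φ x x' = φ x' x := fun x x' => by
    simp only [φ]
    rw [X.edgeWeight_comm, dist_comm (g x), dist_comm (f x)]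
  let ψ : V → V → ℝ := fun x x' => if X.proj x = z₀ then φ x x' else 0
  have hψ : ∀ (γ : Γ) x x', ψ (γ • x) (γ • x') = ψ x x' := fun γ x x' => by
    simp only [ψ, φ, X.proj_smul, X.edgeWeight_smul, hgeq.dist_smul hgeq, hfeq.dist_smul hfeq]
  have hsplit : ∀ x, ∀ x' ∈ X.link x, φ x x' = ψ x x' + ψ x' x := by
    intro x x' hx
    have hne := X.proj_ne_of_mem_link hx
    simp only [ψ]
    by_cases h1 : X.proj x = z₀
    · rw [if_pos h1, if_neg (h1 ▸ hne), add_zero]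
    · by_cases h2 : X.proj x' = z₀
      · rw [if_neg h1, if_pos h2, zero_add, hφ]
      · rw [if_neg h1, if_neg h2]
        simp only [φ]
        rw [hgf x h1, hgf x' h2]
        ring
  have hsum : ∑ z : W, ∑ c ∈ X.link (X.lift z), ψ (X.lift z) c =
      ∑ c ∈ X.link (X.lift z₀), φ (X.lift z₀) c := by
    rw [Finset.sum_eq_single z₀]
    · simp only [ψ, X.proj_lift, if_true]
    · intro z _ hz
      simp only [ψ, X.proj_lift, if_neg hz, Finset.sum_const_zero]
    · simp
  have htotal : ∑ z : W, ∑ c ∈ X.link (X.lift z), φ (X.lift z) c =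
      2 * ∑ c ∈ X.link (X.lift z₀), φ (X.lift z₀) c := by
    have : ∑ z : W, ∑ c ∈ X.link (X.lift z), φ (X.lift z) c =
        ∑ z : W, ∑ c ∈ X.link (X.lift z), (ψ (X.lift z) c + ψ c (X.lift z)) :=
      Finset.sum_congr rfl fun z _ => Finset.sum_congr rfl fun c hc => hsplit _ c hc
    rw [this]
    simp only [Finset.sum_add_distrib]
    rw [← X.sum_link_comm hψ, hsum, two_mul]
  have hdiff : X.energy m g - X.energy m f =
      1 / 2 * ∑ z : W, ∑ c ∈ X.link (X.lift z), φ (X.lift z) c := by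
    simp only [energy, φ, mul_sub, Finset.sum_sub_distrib]
  rw [htotal] at hdiff
  have hlast : ∑ c ∈ X.link (X.lift z₀), φ (X.lift z₀) c =
      ∑ c ∈ X.link (X.lift z₀), X.edgeWeight m (X.lift z₀) c *
        (dist p (f c) ^ 2 - dist (f (X.lift z₀)) (f c) ^ 2) := by
    refine Finset.sum_congr rfl fun c hc => ?_
    have hne := X.proj_ne_of_mem_link hc
    rw [X.proj_lift] at hne
    simp only [φ]
    rw [hg0, hgf c hne]
  linarith

/-- At an almost critical map, the derivative of the energy in the direction of any element of
the tangent cone is almost nonnegative. -/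
theorem sum_le_of_almost_critical [CAT0Space Y] (X : UniversalCovering Z Γ V) (m : Weight Z)
    (ρ : Γ →* (Y ≃ᵢ Y)) {h : W → Y} {ε : ℝ} (hε : 0 ≤ ε)
    (hh : ∀ g, X.rootEnergy m ρ h ≤ X.rootEnergy m ρ g + ε * dist h g) (z₀ : W)
    (b : TangentCone (X.extend ρ h (X.lift z₀))) :
    ∑ c ∈ X.link (X.lift z₀), X.edgeWeight m (X.lift z₀) c *
      (dist (TangentCone.proj (X.extend ρ h (X.lift z₀)) (X.extend ρ h c))
          (TangentCone.apex _) ^ 2 + dist b (TangentCone.apex _) ^ 2 -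
        dist (TangentCone.proj (X.extend ρ h (X.lift z₀)) (X.extend ρ h c)) b ^ 2) ≤
      2 * ε * X.rootEnergy m ρ h * dist b (TangentCone.apex _) := by
  revert b
  set f := X.extend ρ h
  intro b
  induction b using UniformSpace.Completion.induction_on with
  | hp =>
    refine isClosed_le (continuous_finsetSum _ fun c _ => ?_) ?_ <;> fun_prop
  | ih s =>
    have hF := X.rootEnergy_nonneg m ρ h
    set F := X.rootEnergy m ρ h
    set v := dist (s : TangentCone (f (X.lift z₀))) (TangentCone.apex _)
    have key : ∀ δ : ℝ, 0 < δ → ∑ c ∈ X.link (X.lift z₀), X.edgeWeight m (X.lift z₀) c *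
        (dist (TangentCone.proj (f (X.lift z₀)) (f c)) (TangentCone.apex _) ^ 2 + v ^ 2 -
          (dist (TangentCone.proj (f (X.lift z₀)) (f c)) s + δ) ^ 2) ≤ 2 * ε * F * v := by
      intro δ hδ
      choose K hK using fun c => s.exists_eventually_dist_sq_le (f c) (lt_add_of_pos_right
        (dist (TangentCone.proj (f (X.lift z₀)) (f c)) s) hδ)
      set B := fun c => dist (TangentCone.proj (f (X.lift z₀)) (f c)) (TangentCone.apex _) ^ 2 +
        v ^ 2 - (dist (TangentCone.proj (f (X.lift z₀)) (f c)) s + δ) ^ 2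
      have hev : ∀ᶠ t in 𝓝[>] (0 : ℝ),
          ∑ c ∈ X.link (X.lift z₀), X.edgeWeight m (X.lift z₀) c * B c ≤ 2 * ε * F * v +
            t * ∑ c ∈ X.link (X.lift z₀), X.edgeWeight m (X.lift z₀) c * K c := by
        have hall : ∀ᶠ t in 𝓝[>] (0 : ℝ), ∀ c ∈ X.link (X.lift z₀),
            dist (s.toFun t) (f c) ^ 2 ≤ dist (f (X.lift z₀)) (f c) ^ 2 - t * B c +
              t ^ 2 * K c :=
          (Filter.eventually_all_finset _).2 fun c _ => hK c
        filter_upwards [hall, s.eventually_dist_le, self_mem_nhdsWithin] with t ht hst ht0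
        have ht0 : 0 < t := ht0
        have e1 := hh (Function.update h z₀ (s.toFun t))
        have e2 : dist h (Function.update h z₀ (s.toFun t)) ≤ v * t := by
          refine (dist_pi_le_iff (mul_nonneg dist_nonneg ht0.le)).2 fun z => ?_
          by_cases hz : z = z₀
          · subst hz
            rw [Function.update_self, ← X.extend_lift ρ h z]
            exact hst
          · rw [Function.update_of_ne hz, dist_self]
            exact mul_nonneg dist_nonneg ht0.le
        set G := X.rootEnergy m ρ (Function.update h z₀ (s.toFun t))
        have hG : 0 ≤ G := X.rootEnergy_nonneg m ρ _
        have e3 : F ≤ G + ε * (v * t) := e1.trans (by gcongr)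
        have e4 : F ^ 2 - 2 * (ε * (v * t)) * F ≤ G ^ 2 := by
          have : 0 ≤ ε * (v * t) := mul_nonneg hε (mul_nonneg dist_nonneg ht0.le)
          rcases le_total F (ε * (v * t)) with h' | h'
          · nlinarith
          · nlinarith
        have e5 : G ^ 2 = F ^ 2 + _ :=
          (X.rootEnergy_sq m ρ _).trans ((X.energy_extend_update m ρ h z₀ (s.toFun t)).trans
            (by rw [← X.rootEnergy_sq]))
        have e6 : ∑ c ∈ X.link (X.lift z₀), X.edgeWeight m (X.lift z₀) c *
            (dist (s.toFun t) (f c) ^ 2 - dist (f (X.lift z₀)) (f c) ^ 2) ≤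
            ∑ c ∈ X.link (X.lift z₀), X.edgeWeight m (X.lift z₀) c *
              (-(t * B c) + t ^ 2 * K c) :=
          Finset.sum_le_sum fun c hc => mul_le_mul_of_nonneg_left (by linarith [ht c hc])
            (X.edgeWeight_pos m hc).le
        have e7 : ∑ c ∈ X.link (X.lift z₀), X.edgeWeight m (X.lift z₀) c *
              (-(t * B c) + t ^ 2 * K c) =
            t * (t * ∑ c ∈ X.link (X.lift z₀), X.edgeWeight m (X.lift z₀) c * K c -
              ∑ c ∈ X.link (X.lift z₀), X.edgeWeight m (X.lift z₀) c * B c) := by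
          rw [mul_sub, ← mul_assoc, Finset.mul_sum, Finset.mul_sum, ← Finset.sum_sub_distrib]
          exact Finset.sum_congr rfl fun c _ => by ring
        refine le_of_mul_le_mul_left ?_ ht0
        linarith
      have hlim : Tendsto (fun t : ℝ => 2 * ε * F * v +
          t * ∑ c ∈ X.link (X.lift z₀), X.edgeWeight m (X.lift z₀) c * K c) (𝓝[>] 0)
          (𝓝 (2 * ε * F * v +
            0 * ∑ c ∈ X.link (X.lift z₀), X.edgeWeight m (X.lift z₀) c * K c)) :=
        Tendsto.const_add _ <| Tendsto.mul_const _ (tendsto_id.mono_left nhdsWithin_le_nhds)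
      rw [zero_mul, add_zero] at hlim
      exact ge_of_tendsto hlim hev
    have hcont : Continuous fun δ : ℝ => ∑ c ∈ X.link (X.lift z₀),
        X.edgeWeight m (X.lift z₀) c *
        (dist (TangentCone.proj (f (X.lift z₀)) (f c)) (TangentCone.apex _) ^ 2 + v ^ 2 -
          (dist (TangentCone.proj (f (X.lift z₀)) (f c)) s + δ) ^ 2) := by fun_prop
    have hlim := (hcont.tendsto 0).mono_left (nhdsWithin_le_nhds (s := Set.Ioi 0))
    have hle := le_of_tendsto hlim (eventually_mem_nhdsWithin.mono fun δ hδ => key δ hδ)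
    simp only [add_zero] at hle
    exact hle

/-- The Laplacian of an almost critical map is small. -/
theorem dist_negLaplacian_le [CAT0Space Y] (X : UniversalCovering Z Γ V) (m : Weight Z)
    (ρ : Γ →* (Y ≃ᵢ Y)) {h : W → Y} {ε : ℝ} (hε : 0 ≤ ε)
    (hh : ∀ g, X.rootEnergy m ρ h ≤ X.rootEnergy m ρ g + ε * dist h g) (z₀ : W) :
    (∑ c ∈ X.link (X.lift z₀), X.edgeWeight m (X.lift z₀) c) *
      dist (X.negLaplacian m (X.extend ρ h) (X.lift z₀)) (TangentCone.apex _) ≤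
      2 * ε * X.rootEnergy m ρ h := by
  have hnn : 0 ≤ 2 * ε * X.rootEnergy m ρ h :=
    mul_nonneg (by positivity) (X.rootEnergy_nonneg m ρ h)
  rw [negLaplacian]
  split_ifs with hb
  · have hbar := hb.choose_spec (TangentCone.apex _)
    have hsum := X.sum_le_of_almost_critical m ρ hε hh z₀ hb.choose
    set b := hb.choose
    simp only [mul_sub, mul_add, Finset.sum_sub_distrib, Finset.sum_add_distrib] at hsum
    rw [← Finset.sum_mul] at hsum
    rcases (dist_nonneg (x := b) (y := TangentCone.apex _)).eq_or_lt with h0 | h0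
    · rw [← h0, mul_zero]
      exact hnn
    · refine le_of_mul_le_mul_right ?_ h0
      linarith
  · rw [dist_self, mul_zero]
    exact hnn

theorem link_nonempty_of_no_fixed_point (X : UniversalCovering Z Γ V) (ρ : Γ →* (Y ≃ᵢ Y))
    [Nonempty Y] (hρ : ¬ ∃ y : Y, ∀ γ : Γ, ρ γ y = y) (x : V) : (X.link x).Nonempty := by
  by_contra hx
  rw [Finset.not_nonempty_iff_eq_empty] at hx
  have hall : ∀ x', x' = x := X.link_induction (P := fun x' => x' = x) rfl
    (by rintro a b hb rfl; simp [hx] at hb)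
  obtain ⟨y⟩ := ‹Nonempty Y›
  refine hρ ⟨y, fun γ => ?_⟩
  rw [show γ = 1 from X.smul_vertex_injective (v := x) ((hall _).trans (hall _).symm), map_one]
  rfl

theorem rootEnergy_pos_of_no_fixed_point (X : UniversalCovering Z Γ V) (m : Weight Z)
    (ρ : Γ →* (Y ≃ᵢ Y)) (hρ : ¬ ∃ y : Y, ∀ γ : Γ, ρ γ y = y) (h : W → Y) :
    0 < X.rootEnergy m ρ h :=
  Real.sqrt_pos.2 <| (X.energy_nonneg m _).lt_of_ne fun h0 =>
    hρ (X.exists_fixed_point_of_energy_eq_zero m (X.isEquivariant_extend ρ h) h0.symm)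

theorem exists_fixed_point_of_energy_le [CAT0Space Y] [CompleteSpace Y] [Nonempty Y]
    (X : UniversalCovering Z Γ V) (m : Weight Z) (ρ : Γ →* (Y ≃ᵢ Y)) {C : ℝ}
    (hC : ∀ f : V → Y, X.IsEquivariant ρ f → X.energy m f ≤ C * X.normSqLaplacian m f) :
    ∃ y : Y, ∀ γ : Γ, ρ γ y = y := by
  by_contra hρ
  let S : W → ℝ := fun z => ∑ c ∈ X.link (X.lift z), X.edgeWeight m (X.lift z) c
  have hS : ∀ z, 0 < S z := fun z => Finset.sum_pos (fun c hc => X.edgeWeight_pos m hc)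
    (X.link_nonempty_of_no_fixed_point ρ hρ _)
  have hm : ∀ z : W, 0 < m.toFun {z} := fun z => m.pos _ (Z.singleton_mem z)
  let K : ℝ := ∑ z, m.toFun {z} * (2 / S z) ^ 2
  have hK : 0 ≤ K := Finset.sum_nonneg fun z _ => mul_nonneg (hm z).le (sq_nonneg _)
  have hCK : 0 ≤ |C| * K := mul_nonneg (abs_nonneg _) hK
  obtain ⟨ε, hε⟩ : ∃ ε, ε = 1 / (|C| * K + 1) := ⟨_, rfl⟩
  have hε0 : 0 < ε := by rw [hε]; positivity
  have hε1 : |C| * K * ε + ε = 1 := by rw [hε]; field_simp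
  obtain ⟨h, hh⟩ := exists_forall_le_add_mul_dist (X.continuous_rootEnergy m ρ)
    (X.rootEnergy_nonneg m ρ) hε0
  have hF := X.rootEnergy_pos_of_no_fixed_point m ρ hρ h
  have hle := hC _ (X.isEquivariant_extend ρ h)
  rw [← X.rootEnergy_sq] at hle
  set F := X.rootEnergy m ρ h
  have hN0 : 0 ≤ X.normSqLaplacian m (X.extend ρ h) :=
    Finset.sum_nonneg fun z _ => mul_nonneg (hm z).le (sq_nonneg _)
  have hN : X.normSqLaplacian m (X.extend ρ h) ≤ K * (ε * F) ^ 2 := by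
    rw [normSqLaplacian, Finset.sum_mul]
    refine Finset.sum_le_sum fun z _ => ?_
    rw [mul_assoc, ← mul_pow]
    refine mul_le_mul_of_nonneg_left (pow_le_pow_left₀ dist_nonneg ?_ 2) (hm z).le
    rw [div_mul_eq_mul_div, le_div_iff₀ (hS z), mul_comm, ← mul_assoc]
    exact X.dist_negLaplacian_le m ρ hε0.le hh z
  have h1 : F ^ 2 ≤ |C| * (K * (ε * F) ^ 2) :=
    hle.trans ((mul_le_mul_of_nonneg_right (le_abs_self C) hN0).trans
      (mul_le_mul_of_nonneg_left hN (abs_nonneg C)))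
  have h2 : |C| * K * ε * ε < 1 := by nlinarith
  nlinarith [pow_pos hF 2]

theorem isHarmonic_of_forall_rootEnergy_le (X : UniversalCovering Z Γ V) (m : Weight Z)
    (ρ : Γ →* (Y ≃ᵢ Y)) {h : W → Y}
    (hh : ∀ g, X.rootEnergy m ρ h ≤ X.rootEnergy m ρ g) :
    X.IsHarmonic m ρ (X.extend ρ h) := by
  refine ⟨X.isEquivariant_extend ρ h, 1, one_pos, fun g hg _ => ?_⟩
  rw [← hg.extend_eq]
  exact (Real.sqrt_le_sqrt_iff (X.energy_nonneg m _)).1 (hh _)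

end UniversalCovering

end HarmonicMaps

theorem mainTheorem6 {W : Type*} [Fintype W] [DecidableEq W] (Z : AbstractSimplicialComplex W)
    (m : Weight Z) {Γ : Type*} [Group Γ] {V : Type*} [DecidableEq V] [MulAction Γ V]
    (X : UniversalCovering Z Γ V)
    {Y : Type*} [MetricSpace Y] [Nonempty Y] [CompleteSpace Y] [CAT0Space Y]
    (ρ : Γ →* (Y ≃ᵢ Y)) :
    ((∃ y : Y, ∀ γ : Γ, ρ γ y = y) ∨
      (∃ f : V → Y, X.IsHarmonic m ρ f ∧ ∃ x x' : V, f x ≠ f x') ∨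
      (∃ (ω : Ultrafilter ℕ) (r : ℕ → Set.Ioi (0 : ℝ)) (y : ℕ → Y),
        IsAsymptoticConeData ω r y ∧
        ∃ ρω : Γ →* (RescaledLimit ω r Y y ≃ᵢ RescaledLimit ω r Y y),
          IsInducedAction ρ ρω ∧
          ∃ f : V → RescaledLimit ω r Y y, X.IsHarmonic m ρω f ∧ ∃ x x' : V, f x ≠ f x')) ∧
    ((∃ C : ℝ, ∀ f : V → Y, X.IsEquivariant ρ f →
        X.energy m f ≤ C * X.normSqLaplacian m f) →
      ∃ y : Y, ∀ γ : Γ, ρ γ y = y) := by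
  refine ⟨?_, fun ⟨C, hC⟩ => X.exists_fixed_point_of_energy_le m ρ hC⟩
  refine or_iff_not_imp_left.2 fun hρ => ?_
  obtain ⟨x₀⟩ := X.nonempty_vertices
  have z₀ := X.proj x₀
  have y₀ := Classical.arbitrary Y
  have hpos := X.rootEnergy_pos_of_no_fixed_point m ρ hρ
  by_cases hB : ∃ n : ℕ, ∀ h, (∀ g, X.rootEnergy m ρ h ≤
      X.rootEnergy m ρ g + 1 / ((n : ℝ) + 1) * dist h g) → dist y₀ (h z₀) ≤ n
  · left
    obtain ⟨n, hn⟩ := hB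
    obtain ⟨h, hh⟩ := X.exists_minimizer m ρ y₀ z₀ (by positivity) hn
    refine ⟨X.extend ρ h, X.isHarmonic_of_forall_rootEnergy_le m ρ hh, ?_⟩
    by_contra! hc
    have h1 := hpos h
    rw [UniversalCovering.rootEnergy, X.energy_eq_zero_of_const m hc, Real.sqrt_zero] at h1
    exact lt_irrefl _ h1
  · right
    push Not at hB
    choose h hh hdist using hB
    obtain ⟨r, H⟩ := X.exists_isHarmonic_rescaledLimit m ρ
      (ω := hyperfilter ℕ) (by rw [← Nat.cofinite_eq_atTop]; exact hyperfilter_le_cofinite)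
      (fun j => (by positivity : (0 : ℝ) ≤ 1 / ((j : ℝ) + 1)))
      tendsto_one_div_add_atTop_nhds_zero_nat (fun j => hpos (h j)) hh z₀
    refine ⟨hyperfilter ℕ, r, fun j => h j z₀, ⟨hyperfilter_le_cofinite, Or.inr ?_⟩, H⟩
    rw [← Metric.tendsto_dist_left_atTop_iff y₀]
    exact tendsto_atTop_mono (fun j => (hdist j).le) tendsto_natCast_atTop_atTop
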